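/- Conventions. Let $(S,\mu)$ be a probability space and let $X_1,\dots,X_k$ ($k\ge 1$) be independent random variables with law $\mu$. For $f\in L_2(\mu)$ write $\mathbb E f^2=\int f^2\,d\mu$, $\|f\|_{L_2}=(\mathbb E f^2)^{1/2}$, and $\|f\|_{\psi_2}=\inf\{u>0:\mathbb E\exp(f^2/u^2)\le 2\}$. For a class $F\subset L_2(\mu)$ of functions put $\mathrm{diam}(F,\psi_2)=2\sup_{f\in F}\|f\|_{\psi_2}$, and $$\gamma_2(F,\psi_2)=\inf_{(F_s)}\ \sup_{f\in F}\ \sum_{s\ge 0}2^{s/2}\,\inf_{g\in F_s}\|f-g\|_{\psi_2},$$ the infimum being over all sequences of nonempty finite sets $F_s\subset F$ with $|F_0|=1$ and $|F_s|\le 2^{2^s}$ (so $\gamma_2(\emptyset,\psi_2)=\infty$). $F$ is star-shaped if $\lambda f\in F$ whenever $f\in F$ and $0\le\lambda\le 1$. Let $S_{L_2}$ be the unit sphere of $L_2(\mu)$. For $c,\alpha>0$ and $0<\theta<1$ let $$r_k^*(\theta)=\inf\Bigl\{\rho>0:\ \rho\ \ge\ c\,\alpha\,\frac{\gamma_2(F\cap\rho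 S_{L_2},\psi_2)}{\theta\sqrt k}\Bigr\}\in[0,\infty].$$ Below, "$\mathbb E f^2\ge r_k^*(\theta)^2$" allows equality only if the infimum is attained or $r_k^*(\theta)=0$. "With probability at least $p$, every $f\in H$ satisfies $Q$" means: there is an event $E$ with $\mathbb P(E)\ge p$ such that, for every $G\subset H$ which is countable or, more generally, has a countable subset $G_0$ such that each $f\in G$ is the limit, at every point and in $L_2(\mu)$, of a sequence in $G_0$, almost surely on $E$ all $f\in G$ satisfy $Q$ simultaneously. Theorem. There exist absolute constants $c,\bar c>0$ such that the following holds for all $k\ge1$, $0<\theta<1$, $0<\alpha<\infty$ and $F\subset L_2(\mu)$. (a) If $F$ is star-shaped and $\alpha=\mathrm{diam}(F,\psi_2)$, then with probability at least $1-2\exp(-\bar c\,\theta^2k/\alpha^4)$ every $f\in F$ with $\mathbb E f^2\ge r_k^*(\theta)^2$ and $\mathbb E f^2\ge 1$ satisfies $$(1-\theta)\,\mathbb E f^2\ \le\ \frac1k\sum_{i=1}^k f(X_i)^2\ \le\ (1+\theta)\,\mathbb E f^2 .$$ (b) If $F$ is star-shaped and $\alpha=\mathrm{diam}\bigl(\{f/\|f\|_{L_2}: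 f\in F,\ \|f\|_{L_2}\ne 0\},\psi_2\bigr)$ is the $\psi_2$ diameter of the normalized class, then with probability at least $1-2\exp(-\bar c\,\theta^2k/\alpha^4)$ every $f\in F$ with $\mathbb E f^2\ge r_k^*(\theta)^2$ satisfies the same two-sided inequality. (c) If $F\subset S_{L_2}$ (not necessarily star-shaped), $\alpha=\mathrm{diam}(F,\psi_2)$ and $c\,\alpha\,\gamma_2(F,\psi_2)\le\theta\sqrt k$, then with probability at least $1-2\exp(-\bar c\,\theta^2k/\alpha^4)$ every $f\in F$ satisfies $$\Bigl|\frac1k\sum_{i=1}^k f(X_i)^2-1\Bigr|\le\theta .$$ -/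

import Mathlib

open MeasureTheory ProbabilityTheory Filter Topology
open scoped ENNReal

universe u v

noncomputable section

/-- The `ψ₂` norm `inf {u > 0 : 𝔼 exp (f² / u²) ≤ 2}`, with value `∞` if there is no such `u`. -/
def psi2Norm {S : Type u} [MeasurableSpace S] (μ : Measure S) (f : S → ℝ) : ℝ≥0∞ :=
  ⨅ (r : ℝ) (_ : 0 < r ∧ ∫⁻ x, ENNReal.ofReal (Real.exp ((f x) ^ 2 / r ^ 2)) ∂μ ≤ 2),
    ENNReal.ofReal r

/-- The `ψ₂` diameter of a class, with the convention `2 * sup_{f ∈ F} ‖f‖_{ψ₂}` (for a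
symmetric class this is the metric diameter). -/
def psi2Diam {S : Type u} [MeasurableSpace S] (μ : Measure S) (F : Set (S → ℝ)) : ℝ≥0∞ :=
  2 * ⨆ f ∈ F, psi2Norm μ f

/-- Admissible sequences: nonempty finite subsets `A s` of `T` with `|A 0| = 1` and
`|A s| ≤ 2 ^ (2 ^ s)`. -/
structure IsAdmissible {β : Type u} (T : Set β) (A : ℕ → Finset β) : Prop where
  subset : ∀ s, (A s : Set β) ⊆ T
  nonempty : ∀ s, (A s).Nonempty
  card_zero : (A 0).card = 1
  card_le : ∀ s, (A s).card ≤ 2 ^ (2 ^ s)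

/-- The functional `γ₂(T, d) = inf_A sup_{t ∈ T} ∑ₛ 2^{s/2} d(t, A s)`, the infimum over all
admissible sequences. -/
def gamma2 {β : Type u} (T : Set β) (d : β → β → ℝ≥0∞) : ℝ≥0∞ :=
  ⨅ (A : ℕ → Finset β) (_ : IsAdmissible T A),
    ⨆ t ∈ T, ∑' s : ℕ, ENNReal.ofReal ((2 : ℝ) ^ ((s : ℝ) / 2)) * ⨅ a ∈ A s, d t a

/-- `γ₂(F, ‖ ‖_{ψ₂})`. -/
def gamma2Psi2 {S : Type u} [MeasurableSpace S] (μ : Measure S) (F : Set (S → ℝ)) : ℝ≥0∞ :=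
  gamma2 F (fun f g => psi2Norm μ (f - g))

/-- The sphere `ρ S_{L₂}` (intersected with `F`): the `f ∈ F` with `(𝔼 f²)^{1/2} = ρ`. -/
def sphereSection {S : Type u} [MeasurableSpace S] (μ : Measure S) (F : Set (S → ℝ)) (ρ : ℝ) :
    Set (S → ℝ) :=
  {f | f ∈ F ∧ Real.sqrt (∫ x, (f x) ^ 2 ∂μ) = ρ}

/-- The normalized class `{f / ‖f‖_{L₂} : f ∈ F, ‖f‖_{L₂} ≠ 0}`. -/
def normalizedClass {S : Type u} [MeasurableSpace S] (μ : Measure S) (F : Set (S → ℝ)) :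
    Set (S → ℝ) :=
  {g | ∃ f ∈ F, 0 < ∫ x, (f x) ^ 2 ∂μ ∧ g = (Real.sqrt (∫ x, (f x) ^ 2 ∂μ))⁻¹ • f}

/-- The set of `ρ > 0` with `ρ ≥ c α γ₂(F ∩ ρ S_{L₂}, ψ₂) / (θ √k)`. -/
def goodLevels {S : Type u} [MeasurableSpace S] (μ : Measure S) (F : Set (S → ℝ))
    (c α θ : ℝ) (k : ℕ) : Set ℝ :=
  {ρ | 0 < ρ ∧
    ENNReal.ofReal (c * α / (θ * Real.sqrt k)) * gamma2Psi2 μ (sphereSection μ F ρ)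
      ≤ ENNReal.ofReal ρ}

/-- `r*_k(θ)`, the infimum of `goodLevels`, equal to `∞` if there is no good level. -/
def rStar {S : Type u} [MeasurableSpace S] (μ : Measure S) (F : Set (S → ℝ))
    (c α θ : ℝ) (k : ℕ) : ℝ≥0∞ :=
  ⨅ ρ ∈ goodLevels μ F c α θ k, ENNReal.ofReal ρ

/-- The functions `f ∈ F` with `𝔼 f² ≥ r*_k(θ)²`, where equality is allowed only if the infimum
`r*_k(θ)` is attained or is zero. -/
def aboveRStar {S : Type u} [MeasurableSpace S] (μ : Measure S) (F : Set (S → ℝ))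
    (c α θ : ℝ) (k : ℕ) : Set (S → ℝ) :=
  {f | f ∈ F ∧ rStar μ F c α θ k ^ 2 ≤ ENNReal.ofReal (∫ x, (f x) ^ 2 ∂μ) ∧
    (rStar μ F c α θ k ^ 2 = ENNReal.ofReal (∫ x, (f x) ^ 2 ∂μ) →
      rStar μ F c α θ k = 0 ∨
        ∃ ρ ∈ goodLevels μ F c α θ k, ENNReal.ofReal ρ = rStar μ F c α θ k)}

/-- The empirical second moment `(1/k) ∑ᵢ f(xᵢ)²`. -/
def empiricalSq {S : Type u} {k : ℕ} (f : S → ℝ) (x : Fin k → S) : ℝ :=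
  (1 / (k : ℝ)) * ∑ i, (f (x i)) ^ 2

/-- `G` has a countable subset `G₀` such that every `f ∈ G` is the limit, at every point and
in `L₂(μ)`, of a sequence in `G₀`. Every countable class has this property. -/
def PointwiseSeparable {S : Type u} [MeasurableSpace S] (μ : Measure S) (G : Set (S → ℝ)) :
    Prop :=
  ∃ G₀ ⊆ G, G₀.Countable ∧ ∀ f ∈ G, ∃ w : ℕ → S → ℝ, (∀ n, w n ∈ G₀) ∧
    (∀ x, Tendsto (fun n => w n x) atTop (𝓝 (f x))) ∧
    Tendsto (fun n => eLpNorm (w n - f) 2 μ) atTop (𝓝 0)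

/-- "With probability at least `p`, every `f ∈ H` satisfies `Q f`": there is one event `E` of
probability at least `p` such that, for each pointwise separable (in particular, each countable)
`G ⊆ H`, almost surely on `E` all `f ∈ G` satisfy `Q f` simultaneously. -/
def HoldsForAllWithProb {S : Type u} [MeasurableSpace S] (μ : Measure S)
    {Ω : Type v} [MeasurableSpace Ω] (P : Measure Ω) (p : ℝ) (H : Set (S → ℝ))
    (Q : (S → ℝ) → Ω → Prop) : Prop :=
  ∃ E : Set Ω, MeasurableSet E ∧ ENNReal.ofReal p ≤ P E ∧
    ∀ G ⊆ H, PointwiseSeparable μ G → ∀ᵐ ω ∂P, ω ∈ E → ∀ f ∈ G, Q f ω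

/-- `(1 - θ) 𝔼 f² ≤ (1/k) ∑ᵢ f(xᵢ)² ≤ (1 + θ) 𝔼 f²`. -/
def TwoSidedBound {S : Type u} [MeasurableSpace S] (μ : Measure S) {k : ℕ} (θ : ℝ)
    (f : S → ℝ) (x : Fin k → S) : Prop :=
  (1 - θ) * ∫ y, (f y) ^ 2 ∂μ ≤ empiricalSq f x ∧
    empiricalSq f x ≤ (1 + θ) * ∫ y, (f y) ^ 2 ∂μ

end

/-! Two mechanisms carry the theorem: generic chaining on the unit sphere, and rescaling to one
critical sphere.

For unit-norm `f` and `g` with ψ₂ bound `α`, f² - g² = (f - g)(f + g) has mean zero and ψ₁ size at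
most 2α‖f - g‖, up to slack (`IsPsi2Bound.mul`). Bernstein therefore controls increments of the
empirical second moment at scale α‖f - g‖2^{s/2}/√k, as long as 2^s is at most about k. For larger
2^s the Gaussian regime is lost. There the chain is followed in the empirical L₂ norm, where the
triangle inequality and a crude exponential moment suffice; as the norm stays bounded, a small
change of it is a small change of its square. The chain starts not at level 0 but at a level s₀ with
2^{s₀} of order θ²k/α⁴, where a union bound over single functions still gives the required
probability. The links then sum to at most a multiple of γ₂. This is
`ofReal_le_measure_forall_abs_empiricalSq_sub_one_le`, with the deterministic part in
`abs_empiricalSq_sub_one_le_of_chain`. Admissible sets are projected onto the finite class by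
`exists_chain_of_isAdmissible`.

For a star-shaped class, each `f` above the critical radius has a good level below its norm. In a
finite subclass the least such level ρ serves all: ρf/‖f‖ lies in F ∩ ρS, so the normalized
functions inherit the γ₂ bound at ρ (`ofReal_le_measure_forall_twoSidedBound`).

All estimates are for finite subclasses with constants independent of the subclass. Continuity from
above and an essential infimum of events turn them into a single event
(`holdsForAllWithProb_of_finset`). -/

/-! ### From finite subclasses to pointwise separable ones -/

/-- A lower bound on the probability of all finite intersections of a family of events passes to
countable intersections. -/
lemma le_measure_forall_countable {ι : Type*} {Ω : Type*} [MeasurableSpace Ω] {P : Measure Ω}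
    [IsProbabilityMeasure P] {H : Set ι} {Q : ι → Ω → Prop} {p : ℝ≥0∞}
    (hmeas : ∀ f ∈ H, NullMeasurableSet {ω | Q f ω} P)
    (hfin : ∀ G : Finset ι, (G : Set ι) ⊆ H → p ≤ P {ω | ∀ f ∈ G, Q f ω})
    {G : Set ι} (hG : G ⊆ H) (hc : G.Countable) : p ≤ P {ω | ∀ f ∈ G, Q f ω} := by
  classical
  rcases G.eq_empty_or_nonempty with rfl | hne
  · simpa using hfin ∅ (by simp)
  obtain ⟨w, hw⟩ := hc.exists_eq_range hne
  have hwH : ∀ n, w n ∈ H := fun n => hG (hw ▸ Set.mem_range_self n)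
  have hset : {ω | ∀ f ∈ G, Q f ω} = ⋂ n, {ω | Q (w n) ω} := by
    ext ω; simp [hw]
  rw [hset, measure_iInter_eq_iInf_measure_iInter_le (fun n => hmeas _ (hwH n))
    ⟨0, measure_ne_top _ _⟩]
  refine le_iInf fun n => ?_
  refine (hfin ((Finset.range (n + 1)).image w) ?_).trans (measure_mono ?_)
  · intro f hf
    simp only [Finset.coe_image, Set.mem_image] at hf
    obtain ⟨m, -, rfl⟩ := hf
    exact hwH m
  · intro ω hω
    simp only [Set.mem_iInter, Set.mem_ofPred_eq]
    intro j hj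
    exact hω (w j) (Finset.mem_image_of_mem _ (Finset.mem_range.2 (by omega)))

/-- A uniform bound for finite subclasses yields one exceptional event for all pointwise separable
subclasses (an essential infimum of the events attached to countable subclasses). -/
lemma holdsForAllWithProb_of_finset {S : Type u} [MeasurableSpace S] {μ : Measure S}
    {Ω : Type v} [MeasurableSpace Ω] {P : Measure Ω} [IsProbabilityMeasure P] {p : ℝ}
    {H : Set (S → ℝ)} {Q : (S → ℝ) → Ω → Prop}
    (hmeas : ∀ f ∈ H, NullMeasurableSet {ω | Q f ω} P)
    (hclosed : ∀ (f : S → ℝ) (w : ℕ → S → ℝ), f ∈ H → (∀ n, w n ∈ H) →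
      (∀ x, Tendsto (fun n => w n x) atTop (𝓝 (f x))) →
      Tendsto (fun n => eLpNorm (w n - f) 2 μ) atTop (𝓝 0) → ∀ ω, (∀ n, Q (w n) ω) → Q f ω)
    (hfin : ∀ G : Finset (S → ℝ), (G : Set (S → ℝ)) ⊆ H →
      ENNReal.ofReal p ≤ P {ω | ∀ f ∈ G, Q f ω}) :
    HoldsForAllWithProb μ P p H Q := by
  classical
  set E : Set (S → ℝ) → Set Ω := fun G => {ω | ∀ f ∈ G, Q f ω} with hE
  have hcount : ∀ G ⊆ H, G.Countable → ENNReal.ofReal p ≤ P (E G) := fun G hG hc =>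
    le_measure_forall_countable hmeas hfin hG hc
  have hEmeas : ∀ G ⊆ H, G.Countable → NullMeasurableSet (E G) P := by
    intro G hG hc
    have : E G = ⋂ f ∈ G, {ω | Q f ω} := by ext ω; simp [hE]
    rw [this]
    exact NullMeasurableSet.biInter hc fun f hf => hmeas f (hG hf)
  -- a countable subclass minimising the probability
  set V : Set ℝ≥0∞ := {q | ∃ G ⊆ H, G.Countable ∧ P (E G) = q} with hV
  have hVne : V.Nonempty := ⟨_, ∅, Set.empty_subset _, Set.countable_empty, rfl⟩
  obtain ⟨q, -, hqlim, hqV⟩ := exists_seq_tendsto_sInf hVne (OrderBot.bddBelow V)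
  choose G hGH hGc hGq using hqV
  set G' : Set (S → ℝ) := ⋃ n, G n with hG'
  have hG'H : G' ⊆ H := Set.iUnion_subset hGH
  have hG'c : G'.Countable := Set.countable_iUnion hGc
  have hEanti : ∀ A B : Set (S → ℝ), A ⊆ B → E B ⊆ E A := fun A B hAB ω hω f hf => hω f (hAB hf)
  have hG'min : P (E G') ≤ sInf V := by
    refine ge_of_tendsto' hqlim fun n => ?_
    rw [← hGq n]
    exact measure_mono (hEanti _ _ (Set.subset_iUnion G n))
  obtain ⟨t, htE, htm, hteq⟩ := (hEmeas G' hG'H hG'c).exists_measurable_subset_ae_eq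
  refine ⟨t, htm, ?_, ?_⟩
  · rw [measure_congr hteq]; exact hcount G' hG'H hG'c
  · rintro G₁ hG₁ ⟨G₀, hG₀, hG₀c, happ⟩
    have hU : G' ∪ G₀ ⊆ H := Set.union_subset hG'H (hG₀.trans hG₁)
    have hUc : (G' ∪ G₀).Countable := hG'c.union hG₀c
    -- Adjoining `G₀` cannot push the probability below the minimum, so the nested events differ by
    -- a null set.
    have hle : P (E G') ≤ P (E (G' ∪ G₀)) := hG'min.trans (sInf_le ⟨_, hU, hUc, rfl⟩)
    have hsub : E (G' ∪ G₀) ⊆ E G' := hEanti _ _ Set.subset_union_left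
    have hnull : P (E G' \ E (G' ∪ G₀)) = 0 := by
      rw [measure_sdiff hsub (hEmeas _ hU hUc) (measure_ne_top _ _)]
      exact tsub_eq_zero_of_le hle
    have hae : ∀ᵐ ω ∂P, ω ∉ E G' \ E (G' ∪ G₀) := measure_eq_zero_iff_ae_notMem.1 hnull
    filter_upwards [hae] with ω hω hωt f hf
    have hω' : ω ∈ E (G' ∪ G₀) := by
      by_contra h
      exact hω ⟨htE hωt, h⟩
    obtain ⟨w, hw, hwx, hw2⟩ := happ f hf
    exact hclosed f w (hG₁ hf) (fun n => hG₁ (hG₀ (hw n))) hwx hw2 ω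
      fun n => hω' _ (Or.inr (hw n))

/-! ### Measurability and continuity of the second moments -/

lemma aemeasurable_comp_of_hasLaw {S Ω : Type*} [MeasurableSpace S] [MeasurableSpace Ω]
    {μ : Measure S} {P : Measure Ω} {X : Ω → S} (hX : HasLaw X μ P) {f : S → ℝ}
    (hf : AEMeasurable f μ) : AEMeasurable (fun ω => f (X ω)) P := by
  have : AEMeasurable f (P.map X) := by rwa [hX.map_eq]
  exact this.comp_aemeasurable hX.aemeasurable

lemma aemeasurable_empiricalSq {S : Type u} {Ω : Type*} [MeasurableSpace S] [MeasurableSpace Ω]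
    {μ : Measure S} {P : Measure Ω} {k : ℕ} {X : Fin k → Ω → S} (hX : ∀ i, HasLaw (X i) μ P)
    {f : S → ℝ} (hf : AEMeasurable f μ) :
    AEMeasurable (fun ω => empiricalSq f (fun i => X i ω)) P := by
  unfold empiricalSq
  exact (Finset.aemeasurable_fun_sum _ fun i _ =>
    (aemeasurable_comp_of_hasLaw (hX i) hf).pow_const 2).const_mul _

lemma tendsto_empiricalSq {S : Type u} {k : ℕ} {w : ℕ → S → ℝ} {f : S → ℝ}
    (h : ∀ x, Tendsto (fun n => w n x) atTop (𝓝 (f x))) (x : Fin k → S) :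
    Tendsto (fun n => empiricalSq (w n) x) atTop (𝓝 (empiricalSq f x)) := by
  unfold empiricalSq
  exact (tendsto_finsetSum _ fun i _ => (h (x i)).pow 2).const_mul _

lemma tendsto_integral_sq {S : Type u} [MeasurableSpace S] {μ : Measure S} {w : ℕ → S → ℝ}
    {f : S → ℝ} (hw : ∀ n, MemLp (w n) 2 μ) (hf : MemLp f 2 μ)
    (h : Tendsto (fun n => eLpNorm (w n - f) 2 μ) atTop (𝓝 0)) :
    Tendsto (fun n => ∫ y, (w n y) ^ 2 ∂μ) atTop (𝓝 (∫ y, (f y) ^ 2 ∂μ)) := by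
  have key : ∀ {g : S → ℝ} (hg : MemLp g 2 μ), ∫ y, (g y) ^ 2 ∂μ = ‖hg.toLp g‖ ^ 2 := by
    intro g hg
    rw [← real_inner_self_eq_norm_sq, L2.inner_def]
    refine integral_congr_ae ?_
    filter_upwards [hg.coeFn_toLp] with x hx
    simp [hx, sq]
  rw [key hf]
  simp_rw [fun n => key (hw n)]
  exact (((Lp.tendsto_Lp_iff_tendsto_eLpNorm'' w hw f hf).2 h).norm).pow 2

/-! ### Calculus of ψ₂ and ψ₁ bounds -/

/-- The constant `r > 0` satisfies `𝔼 exp (f² / r²) ≤ 2`. -/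
def IsPsi2Bound {S : Type u} [MeasurableSpace S] (μ : Measure S) (f : S → ℝ) (r : ℝ) : Prop :=
  0 < r ∧ ∫⁻ x, ENNReal.ofReal (Real.exp ((f x) ^ 2 / r ^ 2)) ∂μ ≤ 2

/-- The constant `b > 0` satisfies `𝔼 exp (|V| / b) ≤ 2`. -/
def IsPsi1Bound {S : Type u} [MeasurableSpace S] (μ : Measure S) (V : S → ℝ) (b : ℝ) : Prop :=
  0 < b ∧ ∫⁻ x, ENNReal.ofReal (Real.exp (|V x| / b)) ∂μ ≤ 2

section Orlicz

variable {S : Type u} [MeasurableSpace S] {μ : Measure S} {f g h V : S → ℝ} {r s b : ℝ}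

lemma IsPsi2Bound.mono (hf : IsPsi2Bound μ f r) (hfg : ∀ x, |g x| ≤ |f x|) (hrs : r ≤ s) :
    IsPsi2Bound μ g s := by
  refine ⟨hf.1.trans_le hrs, (lintegral_mono fun x => ?_).trans hf.2⟩
  refine ENNReal.ofReal_le_ofReal (Real.exp_le_exp.2 ?_)
  exact div_le_div₀ (sq_nonneg _) (sq_le_sq.2 (hfg x)) (pow_pos hf.1 2)
    (pow_le_pow_left₀ hf.1.le hrs 2)

/-- Admissible constants are upward closed, so strict inequality replaces attainment of the infimum.
-/
lemma isPsi2Bound_of_psi2Norm_lt (hf : psi2Norm μ f < ENNReal.ofReal r) : IsPsi2Bound μ f r := by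
  unfold psi2Norm at hf
  simp only [iInf_lt_iff] at hf
  obtain ⟨t, ht, htr⟩ := hf
  exact IsPsi2Bound.mono (f := f) ht (fun _ => le_rfl) (ENNReal.ofReal_lt_ofReal_iff'.1 htr).1.le

lemma IsPsi2Bound.psi2Norm_le (hf : IsPsi2Bound μ f r) : psi2Norm μ f ≤ ENNReal.ofReal r :=
  iInf₂_le r hf

lemma psi2Norm_mono (hfg : ∀ x, |g x| ≤ |f x|) : psi2Norm μ g ≤ psi2Norm μ f :=
  le_iInf₂ fun _ hr => (IsPsi2Bound.mono (f := f) hr hfg le_rfl).psi2Norm_le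

lemma psi2Norm_sub_comm (f g : S → ℝ) : psi2Norm μ (f - g) = psi2Norm μ (g - f) :=
  le_antisymm (psi2Norm_mono fun _ => (abs_sub_comm _ _).le)
    (psi2Norm_mono fun _ => (abs_sub_comm _ _).le)

lemma IsPsi2Bound.smul {c : ℝ} (hc : 0 < c) (hf : IsPsi2Bound μ f r) :
    IsPsi2Bound μ (c • f) (c * r) := by
  refine ⟨mul_pos hc hf.1, (lintegral_mono fun x => ?_).trans hf.2⟩
  refine ENNReal.ofReal_le_ofReal (Real.exp_le_exp.2 (le_of_eq ?_))
  have := hf.1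
  simp only [Pi.smul_apply, smul_eq_mul]
  field_simp

lemma psi2Norm_smul_le {c : ℝ} (hc : 0 < c) (f : S → ℝ) :
    psi2Norm μ (c • f) ≤ ENNReal.ofReal c * psi2Norm μ f := by
  have h0 : ENNReal.ofReal c ≠ 0 := (ENNReal.ofReal_pos.2 hc).ne'
  rw [mul_comm, ← ENNReal.div_le_iff_le_mul (Or.inl h0) (Or.inl ENNReal.ofReal_ne_top)]
  refine le_iInf₂ fun r hr => ?_
  rw [ENNReal.div_le_iff_le_mul (Or.inl h0) (Or.inl ENNReal.ofReal_ne_top), mul_comm,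
    ← ENNReal.ofReal_mul hc.le]
  exact (IsPsi2Bound.smul hc hr).psi2Norm_le

/-- Convex combination of two exponential integrals. -/
lemma lintegral_exp_convex_le {p q : S → ℝ} (hp : AEMeasurable p μ) {a c : ℝ} (ha : 0 ≤ a)
    (hc : 0 ≤ c) (hac : a + c = 1) (hp2 : ∫⁻ x, ENNReal.ofReal (Real.exp (p x)) ∂μ ≤ 2)
    (hq2 : ∫⁻ x, ENNReal.ofReal (Real.exp (q x)) ∂μ ≤ 2) {z : S → ℝ}
    (hz : ∀ x, z x ≤ a * p x + c * q x) :
    ∫⁻ x, ENNReal.ofReal (Real.exp (z x)) ∂μ ≤ 2 := by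
  calc ∫⁻ x, ENNReal.ofReal (Real.exp (z x)) ∂μ
      ≤ ∫⁻ x, (ENNReal.ofReal a * ENNReal.ofReal (Real.exp (p x))
          + ENNReal.ofReal c * ENNReal.ofReal (Real.exp (q x))) ∂μ := by
        refine lintegral_mono fun x => ?_
        rw [← ENNReal.ofReal_mul ha, ← ENNReal.ofReal_mul hc,
          ← ENNReal.ofReal_add (by positivity) (by positivity)]
        refine ENNReal.ofReal_le_ofReal ((Real.exp_le_exp.2 (hz x)).trans ?_)
        simpa using convexOn_exp.2 (Set.mem_univ (p x)) (Set.mem_univ (q x)) ha hc hac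
    _ = ENNReal.ofReal a * ∫⁻ x, ENNReal.ofReal (Real.exp (p x)) ∂μ
          + ENNReal.ofReal c * ∫⁻ x, ENNReal.ofReal (Real.exp (q x)) ∂μ := by
        rw [lintegral_add_left' (by fun_prop), lintegral_const_mul' _ _ ENNReal.ofReal_ne_top,
          lintegral_const_mul' _ _ ENNReal.ofReal_ne_top]
    _ ≤ ENNReal.ofReal a * 2 + ENNReal.ofReal c * 2 := by gcongr
    _ = 2 := by
        rw [← add_mul, ← ENNReal.ofReal_add ha hc, hac, ENNReal.ofReal_one, one_mul]

/-- With weights r/(r+s) and s/(r+s), convexity of the square bounds ((f+g)/(r+s))² by the average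
of (f/r)² and (g/s)²; the defect is an explicit square. -/
lemma IsPsi2Bound.add (hfm : AEMeasurable f μ) (hf : IsPsi2Bound μ f r) (hg : IsPsi2Bound μ g s) :
    IsPsi2Bound μ (f + g) (r + s) := by
  have hr := hf.1
  have hs := hg.1
  refine ⟨add_pos hr hs, lintegral_exp_convex_le (a := r / (r + s)) (c := s / (r + s))
    (by fun_prop) (by positivity) (by positivity) (by field_simp) hf.2 hg.2 fun x => ?_⟩
  have : r / (r + s) * ((f x) ^ 2 / r ^ 2) + s / (r + s) * ((g x) ^ 2 / s ^ 2)
      - ((f + g) x) ^ 2 / (r + s) ^ 2 = (s * f x - r * g x) ^ 2 / (r * s * (r + s) ^ 2) := by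
    simp only [Pi.add_apply]
    field_simp
    ring
  have h2 : 0 ≤ (s * f x - r * g x) ^ 2 / (r * s * (r + s) ^ 2) := by positivity
  linarith

lemma psi2Norm_add_le (hfm : AEMeasurable f μ) :
    psi2Norm μ (f + g) ≤ psi2Norm μ f + psi2Norm μ g := by
  refine ENNReal.le_of_forall_pos_le_add fun ε hε hlt => ?_
  obtain ⟨hf, hg⟩ := ENNReal.add_lt_top.1 hlt
  have key : ∀ {w : S → ℝ}, psi2Norm μ w < ∞ →
      IsPsi2Bound μ w ((psi2Norm μ w).toReal + ε / 2) := by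
    intro w hw
    refine isPsi2Bound_of_psi2Norm_lt ((ENNReal.lt_ofReal_iff_toReal_lt hw.ne).2 ?_)
    have : (0 : ℝ) < ε := hε
    linarith
  refine ((key hf).add hfm (key hg)).psi2Norm_le.trans (le_of_eq ?_)
  have : (psi2Norm μ f).toReal + ε / 2 + ((psi2Norm μ g).toReal + ε / 2)
      = (psi2Norm μ f).toReal + (psi2Norm μ g).toReal + (ε : ℝ) := by ring
  rw [this, ENNReal.ofReal_add (by positivity) (by positivity),
    ENNReal.ofReal_add (by positivity) (by positivity), ENNReal.ofReal_toReal hf.ne,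
    ENNReal.ofReal_toReal hg.ne, ENNReal.ofReal_coe_nnreal]

lemma psi2Norm_sub_le_sub_add_sub (hfm : AEMeasurable f μ) (hgm : AEMeasurable g μ) :
    psi2Norm μ (f - h) ≤ psi2Norm μ (f - g) + psi2Norm μ (g - h) := by
  rw [← sub_add_sub_cancel f g h]
  exact psi2Norm_add_le (hfm.sub hgm)

lemma psi2Norm_sub_le (hfm : AEMeasurable f μ) :
    psi2Norm μ (f - g) ≤ psi2Norm μ f + psi2Norm μ g := by
  rw [sub_eq_add_neg]
  refine (psi2Norm_add_le hfm).trans (add_le_add le_rfl (psi2Norm_mono fun x => ?_))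
  simp

/-- By AM-GM, |fg|/(rs) is at most the mean of (f/r)² and (g/s)². This makes squares and differences
of squares subexponential. -/
lemma IsPsi2Bound.mul (hfm : AEMeasurable f μ) (hf : IsPsi2Bound μ f r)
    (hg : IsPsi2Bound μ g s) : IsPsi1Bound μ (f * g) (r * s) := by
  have hr := hf.1
  have hs := hg.1
  refine ⟨mul_pos hr hs, lintegral_exp_convex_le (a := 1 / 2) (c := 1 / 2)
    (by fun_prop) (by norm_num) (by norm_num) (by norm_num) hf.2 hg.2 fun x => ?_⟩
  have h1 : |(f * g) x| / (r * s) = |f x| / r * (|g x| / s) := by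
    rw [Pi.mul_apply, abs_mul]; field_simp
  have h2 : (f x) ^ 2 / r ^ 2 = (|f x| / r) ^ 2 := by rw [div_pow, sq_abs]
  have h3 : (g x) ^ 2 / s ^ 2 = (|g x| / s) ^ 2 := by rw [div_pow, sq_abs]
  rw [h1, h2, h3]
  nlinarith [sq_nonneg (|f x| / r - |g x| / s)]

end Orlicz

/-! ### Moment generating function of a ψ₁ variable -/

lemma exp_le_one_add_add_sq_mul_exp_abs (x : ℝ) :
    Real.exp x ≤ 1 + x + x ^ 2 * Real.exp |x| := by
  have h1 : 1 ≤ Real.exp |x| := Real.one_le_exp (abs_nonneg x)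
  rcases le_total |x| 1 with h | h
  · have := (abs_le.1 (Real.abs_exp_sub_one_sub_id_le h)).2
    nlinarith [mul_nonneg (sq_nonneg x) (sub_nonneg.2 h1)]
  · have hx2 : 1 ≤ x ^ 2 := by rw [← sq_abs]; nlinarith
    rcases le_total 0 x with h0 | h0
    · rw [abs_of_nonneg h0] at *
      nlinarith
    · rw [abs_of_nonpos h0] at h
      have h3 : Real.exp x ≤ 1 := Real.exp_le_one_iff.2 h0
      have : x ^ 2 * 1 ≤ x ^ 2 * Real.exp |x| := by gcongr
      nlinarith

/-- Half of the exponent pays for the quadratic factor, so the Taylor remainder stays within one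
exponential moment. -/
lemma sq_mul_exp_half_le {y : ℝ} (hy : 0 ≤ y) : y ^ 2 * Real.exp (y / 2) ≤ 8 * Real.exp y := by
  have h1 : (y / 2) ^ 2 / 2 ≤ Real.exp (y / 2) := by
    have := Real.quadratic_le_exp_of_nonneg (x := y / 2) (by positivity)
    nlinarith
  have h2 : Real.exp y = Real.exp (y / 2) * Real.exp (y / 2) := by rw [← Real.exp_add]; ring_nf
  rw [h2]
  nlinarith [Real.exp_pos (y / 2)]

section Bernstein

variable {S : Type u} [MeasurableSpace S] {μ : Measure S} {V : S → ℝ} {b : ℝ}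

lemma IsPsi1Bound.integrable_exp (hV : IsPsi1Bound μ V b) (hVm : AEMeasurable V μ) :
    Integrable (fun x => Real.exp (|V x| / b)) μ := by
  refine ⟨by have := hVm.abs; exact (by fun_prop : AEMeasurable _ μ).aestronglyMeasurable, ?_⟩
  rw [hasFiniteIntegral_iff_ofReal (ae_of_all _ fun x => (Real.exp_pos _).le)]
  exact hV.2.trans_lt (by simp)

lemma IsPsi1Bound.integral_exp_le (hV : IsPsi1Bound μ V b) (hVm : AEMeasurable V μ) :
    ∫ x, Real.exp (|V x| / b) ∂μ ≤ 2 := by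
  rw [integral_eq_lintegral_of_nonneg_ae (ae_of_all _ fun x => (Real.exp_pos _).le)
    (hV.integrable_exp hVm).1]
  exact ENNReal.toReal_le_of_le_ofReal (by norm_num) (by simpa using hV.2)

lemma IsPsi1Bound.integrable (hV : IsPsi1Bound μ V b) (hVm : AEMeasurable V μ) :
    Integrable V μ := by
  refine ((hV.integrable_exp hVm).const_mul b).mono' hVm.aestronglyMeasurable
    (ae_of_all _ fun x => ?_)
  have hb := hV.1
  have := Real.add_one_le_exp (|V x| / b)
  rw [Real.norm_eq_abs]
  calc |V x| = b * (|V x| / b) := by field_simp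
    _ ≤ _ := by gcongr; linarith

lemma IsPsi1Bound.integrable_exp_mul (hV : IsPsi1Bound μ V b) (hVm : AEMeasurable V μ) {l : ℝ}
    (hl : |l| * b ≤ 1) : Integrable (fun x => Real.exp (l * V x)) μ := by
  refine (hV.integrable_exp hVm).mono'
    (by fun_prop : AEMeasurable _ μ).aestronglyMeasurable (ae_of_all _ fun x => ?_)
  have hb := hV.1
  rw [Real.norm_eq_abs, Real.abs_exp, Real.exp_le_exp, le_div_iff₀ hb]
  calc l * V x * b ≤ |l * V x| * b := by gcongr; exact le_abs_self _
    _ = (|l| * b) * |V x| := by rw [abs_mul]; ring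
    _ ≤ 1 * |V x| := by gcongr
    _ = |V x| := one_mul _

/-- Taylor expansion keeps the mean as the linear term. Since |l|b ≤ 1/2, the remainder is at most
8l²b² exp(|V|/b), whose integral is at most 16l²b². -/
lemma IsPsi1Bound.mgf_le [IsProbabilityMeasure μ] (hV : IsPsi1Bound μ V b)
    (hVm : AEMeasurable V μ) {l : ℝ}
    (hl : |l| * b ≤ 1 / 2) :
    mgf V μ l ≤ Real.exp (l * ∫ x, V x ∂μ + 16 * l ^ 2 * b ^ 2) := by
  have hb := hV.1
  have hpt : ∀ x, Real.exp (l * V x) ≤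
      1 + l * V x + 8 * l ^ 2 * b ^ 2 * Real.exp (|V x| / b) := by
    intro x
    set y := |V x| / b with hy
    have hy0 : 0 ≤ y := by positivity
    have hVy : |V x| = b * y := by rw [hy]; field_simp
    have h1 : (l * V x) ^ 2 = l ^ 2 * b ^ 2 * y ^ 2 := by
      rw [mul_pow, ← sq_abs (V x), hVy]; ring
    have h2 : |l * V x| ≤ y / 2 := by
      rw [abs_mul, hVy]; nlinarith
    calc Real.exp (l * V x) ≤ 1 + l * V x + (l * V x) ^ 2 * Real.exp |l * V x| :=
          exp_le_one_add_add_sq_mul_exp_abs _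
      _ ≤ 1 + l * V x + (l ^ 2 * b ^ 2 * y ^ 2) * Real.exp (y / 2) := by rw [h1]; gcongr
      _ = 1 + l * V x + l ^ 2 * b ^ 2 * (y ^ 2 * Real.exp (y / 2)) := by ring
      _ ≤ 1 + l * V x + l ^ 2 * b ^ 2 * (8 * Real.exp y) := by
          have := mul_le_mul_of_nonneg_left (sq_mul_exp_half_le hy0)
            (by positivity : 0 ≤ l ^ 2 * b ^ 2)
          linarith
      _ = _ := by ring
  have hi := hV.integrable hVm
  have he := hV.integrable_exp hVm
  have hi' : Integrable (fun x => 1 + l * V x) μ := (integrable_const _).add (hi.const_mul l)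
  calc mgf V μ l ≤ ∫ x, (1 + l * V x + 8 * l ^ 2 * b ^ 2 * Real.exp (|V x| / b)) ∂μ :=
        integral_mono (hV.integrable_exp_mul hVm (by linarith))
          (hi'.add (he.const_mul _)) hpt
    _ = 1 + l * ∫ x, V x ∂μ + 8 * l ^ 2 * b ^ 2 * ∫ x, Real.exp (|V x| / b) ∂μ := by
        rw [integral_add hi' (he.const_mul _),
          integral_add (integrable_const _) (hi.const_mul l), integral_const_mul,
          integral_const_mul]
        simp
    _ ≤ 1 + l * ∫ x, V x ∂μ + 8 * l ^ 2 * b ^ 2 * 2 := by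
        gcongr; exact hV.integral_exp_le hVm
    _ = (l * ∫ x, V x ∂μ + 16 * l ^ 2 * b ^ 2) + 1 := by ring
    _ ≤ _ := Real.add_one_le_exp _

end Bernstein

/-! ### Tail bounds for sums over the sample -/

section Sample

variable {S : Type u} [MeasurableSpace S] {μ : Measure S} {Ω : Type v} [MeasurableSpace Ω]
  {P : Measure Ω} {k : ℕ} {X : Fin k → Ω → S} {V : S → ℝ} {b : ℝ}

lemma mgf_comp_of_hasLaw {Y : Ω → S} (hY : HasLaw Y μ P) (hVm : AEMeasurable V μ) (l : ℝ) :
    mgf (fun ω => V (Y ω)) P l = mgf V μ l :=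
  hY.integral_comp (f := fun x => Real.exp (l * V x))
    (by fun_prop : AEMeasurable _ μ).aestronglyMeasurable

/-- Exponential Markov inequality for the sum of an i.i.d. sample. -/
lemma measureReal_le_sum_sample_le [IsProbabilityMeasure P] (hX : ∀ i, HasLaw (X i) μ P)
    (hind : iIndepFun X P) (hVm : AEMeasurable V μ) {l : ℝ} (hl : 0 ≤ l)
    (hint : Integrable (fun x => Real.exp (l * V x)) μ) (a : ℝ) :
    P.real {ω | a ≤ ∑ i, V (X i ω)} ≤ Real.exp (-l * a) * mgf V μ l ^ k := by
  have hm : ∀ i, AEMeasurable (fun ω => V (X i ω)) P :=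
    fun i => aemeasurable_comp_of_hasLaw (hX i) hVm
  have hind' : iIndepFun (fun i ω => V (X i ω)) P :=
    hind.comp₀ (fun _ => V) (fun i => (hX i).aemeasurable)
      (fun i => by rw [(hX i).map_eq]; exact hVm)
  have hi : ∀ i, Integrable (fun ω => Real.exp (l * V (X i ω))) P := fun i => by
    have h : Integrable (fun x => Real.exp (l * V x)) (P.map (X i)) := by rwa [(hX i).map_eq]
    exact h.comp_aemeasurable (hX i).aemeasurable
  -- By independence the mgf of the sum is a product of positive factors; a non-integrable
  -- exponential would give it the default value 0.
  have hI : Integrable (fun ω => Real.exp (l * (∑ i, fun ω => V (X i ω)) ω)) P := by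
    by_contra hn
    have h0 : 0 < mgf (∑ i, fun ω => V (X i ω)) P l := by
      rw [hind'.mgf_sum₀ hm]
      exact Finset.prod_pos fun i _ => mgf_pos (hi i)
    exact h0.ne' (mgf_undef hn)
  have h := measure_ge_le_exp_mul_mgf a hl hI
  rw [hind'.mgf_sum₀ hm] at h
  simpa [Finset.sum_apply, mgf_comp_of_hasLaw (hX _) hVm] using h

lemma IsPsi1Bound.neg (hV : IsPsi1Bound μ V b) : IsPsi1Bound μ (fun x => -V x) b := by
  refine ⟨hV.1, ?_⟩
  simpa using hV.2

lemma IsPsi1Bound.measureReal_le_sum_sample_sub_le [IsProbabilityMeasure μ]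
    [IsProbabilityMeasure P] (hX : ∀ i, HasLaw (X i) μ P)
    (hind : iIndepFun X P) (hV : IsPsi1Bound μ V b) (hVm : AEMeasurable V μ) {t : ℝ} (ht : 0 ≤ t)
    (htb : t ≤ 16 * b) :
    P.real {ω | k * t ≤ ∑ i, V (X i ω) - k * ∫ x, V x ∂μ}
      ≤ Real.exp (-(k * t ^ 2 / (64 * b ^ 2))) := by
  have hb := hV.1
  -- This minimizes -lt + 16l²b², with value -t²/(64b²); the constraint lb ≤ 1/2 is exactly t ≤ 16b.
  set l := t / (32 * b ^ 2) with hl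
  have hl0 : 0 ≤ l := by positivity
  have hlb : |l| * b ≤ 1 / 2 := by
    rw [abs_of_nonneg hl0, hl, div_mul_eq_mul_div, div_le_iff₀ (by positivity)]
    nlinarith
  have h := measureReal_le_sum_sample_le hX hind hVm hl0
    (hV.integrable_exp_mul hVm (by linarith)) (k * t + k * ∫ x, V x ∂μ)
  have hset : {ω | k * t ≤ ∑ i, V (X i ω) - k * ∫ x, V x ∂μ}
      = {ω | k * t + k * ∫ x, V x ∂μ ≤ ∑ i, V (X i ω)} := by
    ext ω; simp only [Set.mem_ofPred_eq, le_sub_iff_add_le]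
  rw [hset]
  refine h.trans ?_
  calc Real.exp (-l * (k * t + k * ∫ x, V x ∂μ)) * mgf V μ l ^ k
      ≤ Real.exp (-l * (k * t + k * ∫ x, V x ∂μ))
          * Real.exp (l * ∫ x, V x ∂μ + 16 * l ^ 2 * b ^ 2) ^ k := by
        gcongr
        · exact mgf_nonneg
        · exact hV.mgf_le hVm hlb
    _ = Real.exp (-(k * t ^ 2 / (64 * b ^ 2))) := by
        rw [← Real.exp_nat_mul, ← Real.exp_add, hl]
        congr 1
        field_simp
        ring

/-- Bernstein's inequality for the empirical mean of a subexponential function. -/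
lemma IsPsi1Bound.measureReal_le_abs_sum_sample_sub_le [IsProbabilityMeasure μ]
    [IsProbabilityMeasure P] (hX : ∀ i, HasLaw (X i) μ P)
    (hind : iIndepFun X P) (hV : IsPsi1Bound μ V b) (hVm : AEMeasurable V μ) {t : ℝ} (ht : 0 ≤ t)
    (htb : t ≤ 16 * b) :
    P.real {ω | k * t ≤ |∑ i, V (X i ω) - k * ∫ x, V x ∂μ|}
      ≤ 2 * Real.exp (-(k * t ^ 2 / (64 * b ^ 2))) := by
  have h1 := hV.measureReal_le_sum_sample_sub_le hX hind hVm ht htb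
  have h2 := hV.neg.measureReal_le_sum_sample_sub_le hX hind hVm.neg ht htb
  have hsub : {ω | k * t ≤ |∑ i, V (X i ω) - k * ∫ x, V x ∂μ|}
      ⊆ {ω | k * t ≤ ∑ i, V (X i ω) - k * ∫ x, V x ∂μ}
        ∪ {ω | k * t ≤ ∑ i, -V (X i ω) - k * ∫ x, -V x ∂μ} := by
    intro ω hω
    rcases le_abs.1 (Set.mem_ofPred_eq ▸ hω : k * t ≤ |_|) with h | h
    · exact Or.inl h
    · refine Or.inr ?_
      simp only [Set.mem_ofPred_eq, Finset.sum_neg_distrib, integral_neg]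
      linarith
  calc P.real _ ≤ P.real _ := measureReal_mono hsub
    _ ≤ _ := measureReal_union_le _ _
    _ ≤ _ := by linarith

/-- Without centring, each factor of the mgf at 1/b is at most 2. The loss 2^k is harmless once `t`
dominates `k`. -/
lemma IsPsi1Bound.measureReal_le_sum_sample_le_exp
    [IsProbabilityMeasure P] (hX : ∀ i, HasLaw (X i) μ P)
    (hind : iIndepFun X P) (hV : IsPsi1Bound μ V b) (hVm : AEMeasurable V μ) (t : ℝ) :
    P.real {ω | b * t ≤ ∑ i, V (X i ω)} ≤ 2 ^ k * Real.exp (-t) := by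
  have hb := hV.1
  have hbb : |1 / b| * b ≤ 1 := by rw [abs_of_pos (by positivity)]; field_simp; rfl
  have h := measureReal_le_sum_sample_le hX hind hVm (l := 1 / b) (by positivity)
    (hV.integrable_exp_mul hVm hbb) (b * t)
  refine h.trans ?_
  have hm : mgf V μ (1 / b) ≤ 2 := by
    refine le_trans (integral_mono (hV.integrable_exp_mul hVm hbb) (hV.integrable_exp hVm) ?_)
      (hV.integral_exp_le hVm)
    intro x
    refine Real.exp_le_exp.2 ?_
    rw [one_div, inv_mul_eq_div]
    gcongr
    exact le_abs_self _
  calc _ = mgf V μ (1 / b) ^ k * Real.exp (-t) := by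
        rw [mul_comm]; congr 2; field_simp
    _ ≤ _ := by gcongr; exact mgf_nonneg

end Sample

/-! ### Deterministic chaining -/

lemma two_rpow_half_sq (s : ℕ) : ((2 : ℝ) ^ ((s : ℝ) / 2)) ^ 2 = 2 ^ s := by
  rw [← Real.rpow_natCast, ← Real.rpow_mul (by norm_num)]
  norm_num

lemma two_rpow_half_pos (s : ℕ) : 0 < (2 : ℝ) ^ ((s : ℝ) / 2) := by positivity

lemma empiricalSq_nonneg {S : Type u} {k : ℕ} (f : S → ℝ) (x : Fin k → S) :
    0 ≤ empiricalSq f x := by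
  unfold empiricalSq; positivity

lemma sqrt_empiricalSq_sub_eq_dist {S : Type u} {k : ℕ} (f g : S → ℝ) (x : Fin k → S) :
    Real.sqrt (empiricalSq (f - g) x) = (Real.sqrt k)⁻¹ *
      dist (WithLp.toLp 2 (fun i => f (x i)) : EuclideanSpace ℝ (Fin k))
        (WithLp.toLp 2 (fun i => g (x i))) := by
  rw [EuclideanSpace.dist_eq, empiricalSq, Real.sqrt_mul (by positivity)]
  simp [Real.dist_eq]

/-- The root of the empirical second moment is k^{-1/2} times the Euclidean norm of the sample
vector, so this is the triangle inequality along the chain. -/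
lemma abs_sqrt_empiricalSq_sub_le {S : Type u} {k : ℕ} (φ : ℕ → S → ℝ) (x : Fin k → S) {m n : ℕ}
    (hmn : m ≤ n) :
    |Real.sqrt (empiricalSq (φ m) x) - Real.sqrt (empiricalSq (φ n) x)|
      ≤ ∑ s ∈ Finset.Ico m n, Real.sqrt (empiricalSq (φ s - φ (s + 1)) x) := by
  set D : ℕ → EuclideanSpace ℝ (Fin k) := fun s => WithLp.toLp 2 (fun i => φ s (x i)) with hD
  have hz : ∀ s, Real.sqrt (empiricalSq (φ s) x) = (Real.sqrt k)⁻¹ * dist (D s) 0 := by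
    intro s
    have := sqrt_empiricalSq_sub_eq_dist (φ s) 0 x
    rw [show (WithLp.toLp 2 (fun i => (0 : S → ℝ) (x i)) : EuclideanSpace ℝ (Fin k)) = 0 from rfl,
      sub_zero] at this
    exact this
  have hc : 0 ≤ (Real.sqrt k)⁻¹ := by positivity
  rw [hz, hz, ← mul_sub, abs_mul, abs_of_nonneg hc]
  simp_rw [sqrt_empiricalSq_sub_eq_dist]
  rw [← Finset.mul_sum]
  gcongr
  exact (abs_dist_sub_le _ _ _).trans (dist_le_Ico_sum_dist D hmn)

/-- The deterministic part of the chaining argument: control of the links of a chain from level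
`s₀` to level `N` gives control of the empirical second moment of its end point. -/
lemma abs_empiricalSq_sub_one_le_of_chain {S : Type u} {k : ℕ} (hk : 1 ≤ k) {α θ : ℝ} (hα : 1 ≤ α)
    (hθ : 0 < θ) (hθ1 : θ < 1) (x : Fin k → S) (φ : ℕ → S → ℝ) (r : ℕ → ℝ) (hr : ∀ s, 0 ≤ r s)
    {s₀ N : ℕ} (hN : s₀ ≤ N) (h0 : |empiricalSq (φ s₀) x - 1| ≤ θ / 4)
    (hinc : ∀ s ∈ Finset.Ico s₀ N, 4 * 2 ^ s ≤ (k : ℝ) →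
      |empiricalSq (φ s) x - empiricalSq (φ (s + 1)) x|
        ≤ 48 * α * r s * (2 : ℝ) ^ ((s : ℝ) / 2) / Real.sqrt k)
    (htail : ∀ s ∈ Finset.Ico s₀ N, (k : ℝ) < 4 * 2 ^ s →
      empiricalSq (φ s - φ (s + 1)) x ≤ r s ^ 2 * (12 * 2 ^ s) / k)
    (hsum : ∑ s ∈ Finset.Ico s₀ N, (2 : ℝ) ^ ((s : ℝ) / 2) * r s ≤ θ * Real.sqrt k / (192 * α)) :
    |empiricalSq (φ N) x - 1| ≤ θ := by
  classical
  have hk0 : (0 : ℝ) < k := by exact_mod_cast hk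
  have hsk : 0 < Real.sqrt k := Real.sqrt_pos.2 hk0
  -- `m` is where the chain leaves the Gaussian regime, truncated at `N`.
  obtain ⟨m, hsm, hmN, hlow, hhigh⟩ : ∃ m, s₀ ≤ m ∧ m ≤ N ∧
      (∀ s ∈ Finset.Ico s₀ m, 4 * 2 ^ s ≤ (k : ℝ)) ∧
      (∀ s ∈ Finset.Ico m N, (k : ℝ) < 4 * 2 ^ s) := by
    have hex : ∃ s, s₀ ≤ s ∧ ((k : ℝ) < 4 * 2 ^ s ∨ N ≤ s) := ⟨N, hN, Or.inr le_rfl⟩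
    refine ⟨Nat.find hex, (Nat.find_spec hex).1, Nat.find_min' hex ⟨hN, Or.inr le_rfl⟩, ?_, ?_⟩
    · intro s hs
      rw [Finset.mem_Ico] at hs
      have := Nat.find_min hex hs.2
      push Not at this
      exact (this hs.1).1
    · intro s hs
      rw [Finset.mem_Ico] at hs
      rcases (Nat.find_spec hex).2 with h | h
      · refine h.trans_le ?_
        gcongr
        · norm_num
        · exact hs.1
      · omega
  set T := ∑ s ∈ Finset.Ico s₀ N, (2 : ℝ) ^ ((s : ℝ) / 2) * r s with hT
  have hpart : ∀ A ⊆ Finset.Ico s₀ N, ∑ s ∈ A, (2 : ℝ) ^ ((s : ℝ) / 2) * r s ≤ T := fun A hA =>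
    Finset.sum_le_sum_of_subset_of_nonneg hA fun s _ _ =>
      mul_nonneg (two_rpow_half_pos s).le (hr s)
  have hTk : T / Real.sqrt k ≤ θ / (192 * α) := by
    rw [div_le_iff₀ hsk]; exact hsum.trans (le_of_eq (by ring))
  -- the links below level `m`
  have h1 : |empiricalSq (φ s₀) x - empiricalSq (φ m) x| ≤ θ / 4 := by
    have ha := dist_le_Ico_sum_dist (fun s => empiricalSq (φ s) x) hsm
    simp only [Real.dist_eq] at ha
    have hsub : Finset.Ico s₀ m ⊆ Finset.Ico s₀ N := Finset.Ico_subset_Ico le_rfl hmN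
    calc _ ≤ _ := ha
      _ ≤ ∑ s ∈ Finset.Ico s₀ m, 48 * α / Real.sqrt k * ((2 : ℝ) ^ ((s : ℝ) / 2) * r s) := by
          refine Finset.sum_le_sum fun s hs => (hinc s (hsub hs) (hlow s hs)).trans (le_of_eq ?_)
          ring
      _ = 48 * α * ((∑ s ∈ Finset.Ico s₀ m, (2 : ℝ) ^ ((s : ℝ) / 2) * r s) / Real.sqrt k) := by
          rw [← Finset.mul_sum]; ring
      _ ≤ 48 * α * (T / Real.sqrt k) := by gcongr; exact hpart _ hsub
      _ ≤ 48 * α * (θ / (192 * α)) := by gcongr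
      _ = θ / 4 := by field_simp; norm_num
  -- the links above level `m`
  have h2 : |Real.sqrt (empiricalSq (φ m) x) - Real.sqrt (empiricalSq (φ N) x)| ≤ θ / 32 := by
    have hsub : Finset.Ico m N ⊆ Finset.Ico s₀ N := Finset.Ico_subset_Ico hsm le_rfl
    calc _ ≤ _ := abs_sqrt_empiricalSq_sub_le φ x hmN
      _ ≤ ∑ s ∈ Finset.Ico m N, 4 / Real.sqrt k * ((2 : ℝ) ^ ((s : ℝ) / 2) * r s) := by
          refine Finset.sum_le_sum fun s hs => ?_
          have hnn : 0 ≤ 4 / Real.sqrt k * ((2 : ℝ) ^ ((s : ℝ) / 2) * r s) :=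
            mul_nonneg (by positivity) (mul_nonneg (two_rpow_half_pos s).le (hr s))
          refine Real.sqrt_le_iff.2 ⟨hnn, (htail s (hsub hs) (hhigh s hs)).trans ?_⟩
          rw [mul_pow, mul_pow, two_rpow_half_sq, div_pow, Real.sq_sqrt hk0.le,
            div_mul_eq_mul_div]
          refine div_le_div_of_nonneg_right ?_ hk0.le
          have : 0 ≤ 2 ^ s * r s ^ 2 := by positivity
          nlinarith
      _ = 4 * ((∑ s ∈ Finset.Ico m N, (2 : ℝ) ^ ((s : ℝ) / 2) * r s) / Real.sqrt k) := by
          rw [← Finset.mul_sum]; ring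
      _ ≤ 4 * (T / Real.sqrt k) := by gcongr; exact hpart _ hsub
      _ ≤ 4 * (θ / (192 * α)) := by gcongr
      _ ≤ 4 * (θ / (192 * 1)) := by gcongr
      _ ≤ θ / 32 := by linarith
  have hm : |empiricalSq (φ m) x - 1| ≤ θ / 2 := by
    rw [abs_le] at *
    constructor <;> linarith
  set y := Real.sqrt (empiricalSq (φ m) x) with hy
  set z := Real.sqrt (empiricalSq (φ N) x) with hz
  have hy2 : y ^ 2 = empiricalSq (φ m) x := Real.sq_sqrt (empiricalSq_nonneg _ _)
  have hz2 : z ^ 2 = empiricalSq (φ N) x := Real.sq_sqrt (empiricalSq_nonneg _ _)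
  have hy0 : 0 ≤ y := Real.sqrt_nonneg _
  have hz0 : 0 ≤ z := Real.sqrt_nonneg _
  rw [← hy2] at hm
  rw [← hz2]
  rw [abs_le] at hm h2
  -- Both roots are bounded by absolute constants, so their θ/32 gap costs less than θ/2 after
  -- squaring.
  have hy54 : y ≤ 5 / 4 := by nlinarith
  have hz54 : z ≤ 3 / 2 := by linarith
  have hprod : |z ^ 2 - y ^ 2| ≤ θ / 2 := by
    have : z ^ 2 - y ^ 2 = (z - y) * (z + y) := by ring
    rw [this, abs_mul, abs_of_nonneg (by positivity : 0 ≤ z + y)]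
    have h3 : |z - y| ≤ θ / 32 := abs_le.2 ⟨by linarith, by linarith⟩
    calc |z - y| * (z + y) ≤ θ / 32 * (3 / 2 + 5 / 4) := by gcongr
      _ ≤ θ / 2 := by linarith
  rw [abs_le] at hprod ⊢
  constructor <;> linarith

/-! ### Probabilities of individual starting points and links -/

/-- Each exponential is at most half the preceding one, so the sum is dominated by a telescoping
one. -/
lemma sum_Ico_exp_neg_two_pow_le {s₀ N : ℕ} (hN : s₀ ≤ N) :
    ∑ s ∈ Finset.Ico s₀ N, 2 * Real.exp (-(5 * 2 ^ s)) ≤ 4 * Real.exp (-(5 * 2 ^ s₀)) := by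
  have hstep : ∀ s : ℕ, Real.exp (-(5 * 2 ^ (s + 1))) ≤ 1 / 2 * Real.exp (-(5 * 2 ^ s)) := by
    intro s
    have h1 : Real.exp (-(5 * 2 ^ (s + 1)))
        = Real.exp (-(5 * 2 ^ s)) * Real.exp (-(5 * 2 ^ s)) := by
      rw [← Real.exp_add]; ring_nf
    rw [h1]
    gcongr
    have h2 : (1 : ℝ) ≤ 2 ^ s := one_le_pow₀ (by norm_num)
    have h3 : (2 : ℝ) ≤ Real.exp (5 * 2 ^ s) := by
      have := Real.add_one_le_exp ((5 : ℝ) * 2 ^ s); linarith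
    rw [Real.exp_neg, one_div]
    gcongr
  have : ∑ s ∈ Finset.Ico s₀ N, 2 * Real.exp (-(5 * 2 ^ s))
      ≤ 4 * (Real.exp (-(5 * 2 ^ s₀)) - Real.exp (-(5 * 2 ^ N))) := by
    induction N, hN using Nat.le_induction with
    | base => simp
    | succ n hn ih =>
      rw [Finset.sum_Ico_succ_top hn]
      have := hstep n
      linarith
  have h := Real.exp_pos (-(5 * 2 ^ N))
  linarith

lemma two_pow_two_pow_le_exp (s : ℕ) : (2 : ℝ) ^ (2 ^ s) ≤ Real.exp (2 ^ s) := by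
  have h : (2 : ℝ) ≤ Real.exp 1 := by have := Real.add_one_le_exp (1 : ℝ); linarith
  calc (2 : ℝ) ^ (2 ^ s) ≤ (Real.exp 1) ^ (2 ^ s) := by gcongr
    _ = Real.exp (2 ^ s) := by rw [← Real.exp_nat_mul]; push_cast; ring_nf

section Links

variable {S : Type u} [MeasurableSpace S] {μ : Measure S} {Ω : Type v}
  [MeasurableSpace Ω] {P : Measure Ω} {k : ℕ} {X : Fin k → Ω → S}
  {f g : S → ℝ} {α θ r : ℝ}

lemma integrable_sq_of_isPsi2Bound (hfm : AEMeasurable f μ) (hf : IsPsi2Bound μ f r) :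
    Integrable (fun x => (f x) ^ 2) μ := by
  simp only [sq]
  exact (hf.mul hfm hf).integrable (hfm.mul hfm)

/-- Integrate 1 + u ≤ exp u with u = f²/r². On the unit sphere this forces α ≥ 1. -/
lemma integral_sq_le_of_isPsi2Bound [IsProbabilityMeasure μ] (hfm : AEMeasurable f μ)
    (hf : IsPsi2Bound μ f r) :
    ∫ x, (f x) ^ 2 ∂μ ≤ r ^ 2 := by
  have hr := hf.1
  have hff := hf.mul hfm hf
  have h1 := hff.integral_exp_le (hfm.mul hfm)
  have h2 : ∫ x, (1 + (f x) ^ 2 / r ^ 2) ∂μ ≤ ∫ x, Real.exp (|(f * f) x| / (r * r)) ∂μ := by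
    refine integral_mono ((integrable_const _).add
      ((integrable_sq_of_isPsi2Bound hfm hf).div_const _)) (hff.integrable_exp (hfm.mul hfm)) ?_
    intro x
    have h3 : |(f * f) x| / (r * r) = (f x) ^ 2 / r ^ 2 := by
      rw [Pi.mul_apply, abs_mul_self, sq, sq]
    have := Real.add_one_le_exp (|(f * f) x| / (r * r))
    simp only
    linarith
  rw [integral_add (integrable_const _) ((integrable_sq_of_isPsi2Bound hfm hf).div_const _),
    integral_div] at h2
  simp only [integral_const, probReal_univ, smul_eq_mul, mul_one] at h2
  have h3 : (∫ x, (f x) ^ 2 ∂μ) / r ^ 2 ≤ 1 := by linarith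
  rwa [div_le_one (by positivity)] at h3

/-- A single function on the unit sphere. -/
lemma measureReal_lt_abs_empiricalSq_sub_one_le [IsProbabilityMeasure μ]
    [IsProbabilityMeasure P] (hk : 1 ≤ k) (hX : ∀ i, HasLaw (X i) μ P)
    (hind : iIndepFun X P) (hα : 1 ≤ α) (hθ : 0 < θ) (hθ1 : θ < 1) (hfm : AEMeasurable f μ)
    (hf : IsPsi2Bound μ f α) (hf1 : ∫ x, (f x) ^ 2 ∂μ = 1) :
    P.real {ω | ¬ |empiricalSq f (fun i => X i ω) - 1| ≤ θ / 4}
      ≤ 2 * Real.exp (-(k * θ ^ 2 / α ^ 4 / 1024)) := by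
  have hk0 : (0 : ℝ) < k := by exact_mod_cast hk
  have h := (hf.mul hfm hf).measureReal_le_abs_sum_sample_sub_le hX hind (hfm.mul hfm)
    (t := θ / 4) (by positivity) (by nlinarith)
  refine (measureReal_mono ?_).trans (h.trans (le_of_eq ?_))
  · intro ω hω
    simp only [Set.mem_ofPred_eq, not_le] at hω ⊢
    have e : ∑ i, (f * f) (X i ω) - k * ∫ x, (f * f) x ∂μ
        = k * (empiricalSq f (fun i => X i ω) - 1) := by
      have : ∫ x, (f * f) x ∂μ = 1 := by simpa [sq] using hf1
      rw [this, empiricalSq]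
      simp only [Pi.mul_apply, sq]
      field_simp
    rw [e, abs_mul, abs_of_pos hk0]
    gcongr
  · congr 3
    field_simp
    norm_num

/-- Increments of the empirical second moment at the Gaussian scale. -/
lemma measureReal_lt_abs_empiricalSq_sub_le [IsProbabilityMeasure μ]
    [IsProbabilityMeasure P] (hk : 1 ≤ k) (hX : ∀ i, HasLaw (X i) μ P)
    (hind : iIndepFun X P) (hα : 1 ≤ α) (hfm : AEMeasurable f μ) (hgm : AEMeasurable g μ)
    (hf : IsPsi2Bound μ f α) (hg : IsPsi2Bound μ g α) (hf1 : ∫ x, (f x) ^ 2 ∂μ = 1)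
    (hg1 : ∫ x, (g x) ^ 2 ∂μ = 1) (hfg : IsPsi2Bound μ (f - g) r) {s : ℕ}
    (hs : 4 * 2 ^ s ≤ (k : ℝ)) :
    P.real {ω | ¬ |empiricalSq f (fun i => X i ω) - empiricalSq g (fun i => X i ω)|
        ≤ 48 * α * r * (2 : ℝ) ^ ((s : ℝ) / 2) / Real.sqrt k} ≤ 2 * Real.exp (-(8 * 2 ^ s)) := by
  have hk0 : (0 : ℝ) < k := by exact_mod_cast hk
  have hsk : 0 < Real.sqrt k := Real.sqrt_pos.2 hk0
  have hr := hfg.1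
  have hq := two_rpow_half_pos s
  have hq2 := two_rpow_half_sq s
  set q := (2 : ℝ) ^ ((s : ℝ) / 2) with hqdef
  have hqk : q / Real.sqrt k ≤ 1 / 2 := by
    rw [div_le_iff₀ hsk]
    have : q ≤ Real.sqrt (k / 4) := Real.le_sqrt_of_sq_le (by rw [hq2]; linarith)
    rw [Real.sqrt_div hk0.le, show (4 : ℝ) = 2 ^ 2 by norm_num,
      Real.sqrt_sq (by norm_num)] at this
    linarith
  have h := (hfg.mul (hfm.sub hgm) (hf.add hfm hg)).measureReal_le_abs_sum_sample_sub_le hX hind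
    ((hfm.sub hgm).mul (hfm.add hgm)) (t := 48 * α * r * q / Real.sqrt k) (by positivity) (by
      have : 48 * α * r * q / Real.sqrt k = 48 * α * r * (q / Real.sqrt k) := by ring
      rw [this]
      calc 48 * α * r * (q / Real.sqrt k) ≤ 48 * α * r * (1 / 2) := by gcongr
        _ ≤ 16 * (r * (α + α)) := by nlinarith [mul_pos hr (by linarith : 0 < α)])
  refine (measureReal_mono ?_).trans (h.trans ?_)
  · intro ω hω
    simp only [Set.mem_ofPred_eq, not_le] at hω ⊢
    have e : ∑ i, ((f - g) * (f + g)) (X i ω) - k * ∫ x, ((f - g) * (f + g)) x ∂μ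
        = k * (empiricalSq f (fun i => X i ω) - empiricalSq g (fun i => X i ω)) := by
      have h0 : ∀ x, ((f - g) * (f + g)) x = (f x) ^ 2 - (g x) ^ 2 := fun x => by
        simp only [Pi.mul_apply, Pi.sub_apply, Pi.add_apply]; ring
      simp_rw [h0]
      rw [integral_sub (integrable_sq_of_isPsi2Bound hfm hf)
        (integrable_sq_of_isPsi2Bound hgm hg), hf1, hg1, Finset.sum_sub_distrib, empiricalSq,
        empiricalSq]
      field_simp
      ring
    rw [e, abs_mul, abs_of_pos hk0]
    gcongr
  -- The constant 48 yields the exponent 9·2^s, which beats the later union over exp(3·2^s) pairs,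
  -- while t stays in Bernstein's range because q/√k ≤ 1/2.
  · have e : k * (48 * α * r * q / Real.sqrt k) ^ 2 / (64 * (r * (α + α)) ^ 2) = 9 * 2 ^ s := by
      rw [div_pow, Real.sq_sqrt hk0.le, ← hq2]
      field_simp
      ring
    rw [e]
    have : (0 : ℝ) < 2 ^ s := by positivity
    gcongr
    linarith

/-- Increments beyond the Gaussian scale. -/
lemma measureReal_lt_empiricalSq_sub_le [IsProbabilityMeasure P] (hk : 1 ≤ k)
    (hX : ∀ i, HasLaw (X i) μ P)
    (hind : iIndepFun X P) (hfm : AEMeasurable f μ) (hf : IsPsi2Bound μ f r) {s : ℕ}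
    (hs : (k : ℝ) < 4 * 2 ^ s) :
    P.real {ω | ¬ empiricalSq f (fun i => X i ω) ≤ r ^ 2 * (12 * 2 ^ s) / k}
      ≤ 2 * Real.exp (-(8 * 2 ^ s)) := by
  have hk0 : (0 : ℝ) < k := by exact_mod_cast hk
  have h := (hf.mul hfm hf).measureReal_le_sum_sample_le_exp hX hind (hfm.mul hfm) (12 * 2 ^ s)
  refine (measureReal_mono ?_).trans (h.trans ?_)
  · intro ω hω
    simp only [Set.mem_ofPred_eq, not_le] at hω ⊢
    rw [empiricalSq, div_lt_iff₀ hk0, one_div, mul_right_comm, inv_mul_cancel₀ hk0.ne',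
      one_mul] at hω
    simp only [Pi.mul_apply, ← sq]
    exact hω.le
  · have h2 : (2 : ℝ) ≤ Real.exp 1 := by have := Real.add_one_le_exp (1 : ℝ); linarith
    calc (2 : ℝ) ^ k * Real.exp (-(12 * 2 ^ s)) ≤ Real.exp 1 ^ k * Real.exp (-(12 * 2 ^ s)) := by
          gcongr
      _ = Real.exp (k + -(12 * 2 ^ s)) := by
          rw [← Real.exp_nat_mul, Real.exp_add, mul_one]
      _ ≤ Real.exp (-(8 * 2 ^ s)) := Real.exp_le_exp.2 (by linarith)
      _ ≤ _ := by linarith [Real.exp_pos (-(8 * 2 ^ s) : ℝ)]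

end Links

/-! ### Union bound over the chain -/

lemma ofReal_one_sub_le_measure_of_compl {Ω : Type*} [MeasurableSpace Ω] {P : Measure Ω}
    [IsProbabilityMeasure P] {A B : Set Ω} {p : ℝ} (hAB : Aᶜ ⊆ B) (hB : P.real B ≤ p) :
    ENNReal.ofReal (1 - p) ≤ P A := by
  rw [← ENNReal.ofReal_toReal (measure_ne_top P A)]
  refine ENNReal.ofReal_le_ofReal ?_
  have h1 : P.real (A ∪ Aᶜ) ≤ P.real A + P.real Aᶜ := measureReal_union_le _ _
  rw [Set.union_compl_self, probReal_univ] at h1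
  have h2 : P.real Aᶜ ≤ P.real B := measureReal_mono hAB
  change _ ≤ P.real A
  linarith

section Chaining

variable {S : Type u} [MeasurableSpace S] {μ : Measure S} [IsProbabilityMeasure μ] {Ω : Type v}
  [MeasurableSpace Ω] {P : Measure Ω} [IsProbabilityMeasure P] {k : ℕ} {X : Fin k → Ω → S}
  {α θ : ℝ}

/-- Generic chaining bound for a finite class on the unit sphere. -/
theorem ofReal_le_measure_forall_abs_empiricalSq_sub_one_le (hk : 1 ≤ k)
    (hX : ∀ i, HasLaw (X i) μ P) (hind : iIndepFun X P) (hα : 0 < α) (hθ : 0 < θ) (hθ1 : θ < 1)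
    {G : Finset (S → ℝ)} (hGne : G.Nonempty) (hGm : ∀ f ∈ G, AEMeasurable f μ)
    (hGα : ∀ f ∈ G, IsPsi2Bound μ f α) (hG1 : ∀ f ∈ G, ∫ x, (f x) ^ 2 ∂μ = 1)
    (B : ℕ → Finset (S → ℝ)) (hBG : ∀ s, B s ⊆ G) (hBc : ∀ s, (B s).card ≤ 2 ^ (2 ^ s))
    (φ : ℕ → (S → ℝ) → S → ℝ) (hφ : ∀ s, ∀ f ∈ G, φ s f ∈ B s) {N : ℕ} (hkN : k ≤ 2 ^ N)
    (hφN : ∀ f ∈ G, φ N f = f) (r : (S → ℝ) → (S → ℝ) → ℝ)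
    (hr : ∀ f ∈ G, ∀ g ∈ G, IsPsi2Bound μ (f - g) (r f g))
    (hsum : ∀ f ∈ G, ∑ s ∈ Finset.range N, (2 : ℝ) ^ ((s : ℝ) / 2) * r (φ s f) (φ (s + 1) f)
      ≤ θ * Real.sqrt k / (192 * α)) :
    ENNReal.ofReal (1 - 2 * Real.exp (-(1 / 16384 * θ ^ 2 * k / α ^ 4)))
      ≤ P {ω | ∀ f ∈ G, |empiricalSq f (fun i => X i ω) - 1| ≤ θ} := by
  classical
  obtain ⟨f₀, hf₀⟩ := hGne
  have hα1 : 1 ≤ α := by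
    have := integral_sq_le_of_isPsi2Bound (hGm f₀ hf₀) (hGα f₀ hf₀)
    rw [hG1 f₀ hf₀] at this
    nlinarith
  have hk0 : (0 : ℝ) < k := by exact_mod_cast hk
  set κ : ℝ := k * θ ^ 2 / α ^ 4 with hκ
  have hexp : 1 / 16384 * θ ^ 2 * k / α ^ 4 = κ / 16384 := by rw [hκ]; ring
  rw [hexp]
  rcases lt_or_ge κ 8192 with hκ1 | hκ1
  -- For κ < 8192 the claimed probability is nonpositive.
  · have : 1 - 2 * Real.exp (-(κ / 16384)) ≤ 0 := by
      have := Real.add_one_le_exp (-(κ / 16384))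
      linarith
    rw [ENNReal.ofReal_of_nonpos this]
    exact zero_le
  have hκk : κ ≤ k := by
    rw [hκ, div_le_iff₀ (by positivity)]
    have h1 : θ ^ 2 ≤ 1 := pow_le_one₀ hθ.le hθ1.le
    have h2 : 1 ≤ α ^ 4 := one_le_pow₀ hα1
    gcongr
    exact h1.trans h2
  -- 2^{s₀} ≤ κ/2048 leaves half of the single-function exponent κ/1024 after the union over `B s₀`;
  -- 2^{s₀+1} > κ/2048 makes the later links as unlikely.
  obtain ⟨s₀, hs₀, hs₀'⟩ := exists_nat_pow_near (x := κ / 2048) (y := (2 : ℝ)) (by linarith)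
    (by norm_num)
  have hs₀N : s₀ ≤ N := by
    have h1 : (2 : ℝ) ^ s₀ ≤ 2 ^ N := by
      have : (k : ℝ) ≤ 2 ^ N := by exact_mod_cast hkN
      linarith
    exact (pow_le_pow_iff_right₀ (by norm_num)).1 h1
  -- the bad events
  set bad₀ : (S → ℝ) → Set Ω := fun f => {ω | ¬ |empiricalSq f (fun i => X i ω) - 1| ≤ θ / 4}
    with hbad₀
  set bad : ℕ → (S → ℝ) × (S → ℝ) → Set Ω := fun s p =>
    if 4 * 2 ^ s ≤ (k : ℝ) then
      {ω | ¬ |empiricalSq p.1 (fun i => X i ω) - empiricalSq p.2 (fun i => X i ω)|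
        ≤ 48 * α * r p.1 p.2 * (2 : ℝ) ^ ((s : ℝ) / 2) / Real.sqrt k}
    else {ω | ¬ empiricalSq (p.1 - p.2) (fun i => X i ω)
        ≤ r p.1 p.2 ^ 2 * (12 * 2 ^ s) / k} with hbad
  set D : Set Ω := (⋃ f ∈ B s₀, bad₀ f) ∪
    ⋃ s ∈ Finset.Ico s₀ N, ⋃ p ∈ B s ×ˢ B (s + 1), bad s p with hD
  have hcard : ∀ s, ((B s).card : ℝ) ≤ Real.exp (2 ^ s) := fun s =>
    le_trans (by exact_mod_cast hBc s) (two_pow_two_pow_le_exp s)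
  have hbadle : ∀ s, ∀ p ∈ B s ×ˢ B (s + 1), P.real (bad s p) ≤ 2 * Real.exp (-(8 * 2 ^ s)) := by
    rintro s ⟨f, g⟩ hp
    rw [Finset.mem_product] at hp
    have hf := hBG _ hp.1
    have hg := hBG _ hp.2
    simp only [hbad]
    split_ifs with h
    · exact measureReal_lt_abs_empiricalSq_sub_le hk hX hind hα1 (hGm f hf) (hGm g hg)
        (hGα f hf) (hGα g hg) (hG1 f hf) (hG1 g hg) (hr f hf g hg) h
    · exact measureReal_lt_empiricalSq_sub_le hk hX hind ((hGm f hf).sub (hGm g hg))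
        (hr f hf g hg) (not_le.1 h)
  have hlevel : ∀ s, P.real (⋃ p ∈ B s ×ˢ B (s + 1), bad s p) ≤ 2 * Real.exp (-(5 * 2 ^ s)) := by
    intro s
    calc _ ≤ ∑ p ∈ B s ×ˢ B (s + 1), P.real (bad s p) := measureReal_biUnion_finset_le _ _
      _ ≤ ∑ p ∈ B s ×ˢ B (s + 1), 2 * Real.exp (-(8 * 2 ^ s)) :=
          Finset.sum_le_sum (hbadle s)
      _ = (B s).card * (B (s + 1)).card * (2 * Real.exp (-(8 * 2 ^ s))) := by
          rw [Finset.sum_const, Finset.card_product, nsmul_eq_mul]; push_cast; ring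
      _ ≤ Real.exp (2 ^ s) * Real.exp (2 ^ (s + 1)) * (2 * Real.exp (-(8 * 2 ^ s))) := by
          gcongr
          · exact hcard s
          · exact hcard (s + 1)
      _ = 2 * Real.exp (-(5 * 2 ^ s)) := by
          rw [← Real.exp_add, mul_left_comm, ← Real.exp_add]
          ring_nf
  have hstart : P.real (⋃ f ∈ B s₀, bad₀ f) ≤ 2 * Real.exp (-(κ / 2048)) := by
    calc _ ≤ ∑ f ∈ B s₀, P.real (bad₀ f) := measureReal_biUnion_finset_le _ _
      _ ≤ ∑ f ∈ B s₀, 2 * Real.exp (-(κ / 1024)) := Finset.sum_le_sum fun f hf =>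
          measureReal_lt_abs_empiricalSq_sub_one_le hk hX hind hα1 hθ hθ1 (hGm f (hBG _ hf))
            (hGα f (hBG _ hf)) (hG1 f (hBG _ hf))
      _ = (B s₀).card * (2 * Real.exp (-(κ / 1024))) := by
          rw [Finset.sum_const, nsmul_eq_mul]
      _ ≤ Real.exp (κ / 2048) * (2 * Real.exp (-(κ / 1024))) := by
          gcongr
          exact (hcard s₀).trans (Real.exp_le_exp.2 hs₀)
      _ = 2 * Real.exp (-(κ / 2048)) := by
          rw [mul_left_comm, ← Real.exp_add]
          ring_nf
  have hDle : P.real D ≤ 2 * Real.exp (-(κ / 16384)) := by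
    have h1 : P.real (⋃ s ∈ Finset.Ico s₀ N, ⋃ p ∈ B s ×ˢ B (s + 1), bad s p)
        ≤ 4 * Real.exp (-(5 * 2 ^ s₀)) :=
      (measureReal_biUnion_finset_le _ _).trans
        ((Finset.sum_le_sum fun s _ => hlevel s).trans (sum_Ico_exp_neg_two_pow_le hs₀N))
    have h2 : Real.exp (-(5 * 2 ^ s₀)) ≤ Real.exp (-(κ / 2048)) := by
      refine Real.exp_le_exp.2 ?_
      rw [pow_succ] at hs₀'
      linarith
    -- The start contributes 2 and the links 4 copies of exp(-κ/2048); the smaller final exponent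
    -- absorbs the factor 3, since κ ≥ 8192.
    have h3 : 3 * Real.exp (-(κ / 2048)) ≤ Real.exp (-(κ / 16384)) := by
      have h4 : Real.exp (-(κ / 16384))
          = Real.exp (7 * κ / 16384) * Real.exp (-(κ / 2048)) := by
        rw [← Real.exp_add]; ring_nf
      rw [h4]
      gcongr
      have := Real.add_one_le_exp (7 * κ / 16384)
      linarith
    calc P.real D ≤ _ := measureReal_union_le _ _
      _ ≤ _ := by linarith
  refine ofReal_one_sub_le_measure_of_compl (B := D) ?_ hDle
  rw [Set.compl_subset_comm]
  intro ω hω f hf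
  simp only [hD, Set.compl_union, Set.mem_inter_iff, Set.mem_compl_iff, Set.mem_iUnion,
    not_exists] at hω
  obtain ⟨hω0, hω1⟩ := hω
  have hlink : ∀ s ∈ Finset.Ico s₀ N, ω ∉ bad s (φ s f, φ (s + 1) f) := fun s hs =>
    hω1 s hs _ (Finset.mem_product.2 ⟨hφ s f hf, hφ (s + 1) f hf⟩)
  have hφG : ∀ s, φ s f ∈ G := fun s => hBG s (hφ s f hf)
  have hrpos : ∀ s, 0 < r (φ s f) (φ (s + 1) f) := fun s => (hr _ (hφG s) _ (hφG (s + 1))).1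
  have h := abs_empiricalSq_sub_one_le_of_chain hk hα1 hθ hθ1 (fun i => X i ω) (fun s => φ s f)
    (fun s => r (φ s f) (φ (s + 1) f)) (fun s => (hrpos s).le) hs₀N ?_ ?_ ?_ ?_
  · simpa only [hφN f hf] using h
  · have := hω0 _ (hφ s₀ f hf)
    simpa [hbad₀] using this
  · intro s hs h4
    have := hlink s hs
    simp only [hbad, if_pos h4] at this
    exact not_not.1 this
  · intro s hs h4
    have := hlink s hs
    simp only [hbad, if_neg (not_le.2 h4)] at this
    exact not_not.1 this
  · refine le_trans ?_ (hsum f hf)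
    rw [Finset.range_eq_Ico]
    exact Finset.sum_le_sum_of_subset_of_nonneg (Finset.Ico_subset_Ico (Nat.zero_le _) le_rfl)
      fun s _ _ => mul_nonneg (two_rpow_half_pos s).le (hrpos s).le

end Chaining

/-! ### Chains from γ₂ -/

lemma psi2Norm_zero {S : Type u} [MeasurableSpace S] {μ : Measure S} [IsProbabilityMeasure μ] :
    psi2Norm μ (0 : S → ℝ) = 0 := by
  refine le_antisymm (ENNReal.le_of_forall_pos_le_add fun ε hε _ => ?_) zero_le
  have h : IsPsi2Bound μ (0 : S → ℝ) ε := ⟨hε, by simp⟩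
  simpa using h.psi2Norm_le

section Gamma

variable {S : Type u} [MeasurableSpace S] {μ : Measure S} [IsProbabilityMeasure μ] {Ω : Type v}
  [MeasurableSpace Ω] {P : Measure Ω} [IsProbabilityMeasure P] {k : ℕ} {X : Fin k → Ω → S}
  {α θ ρ : ℝ}

/-- Projection of an admissible sequence of `T ⊇ ρ • G` onto the finite class `G`. The distances
to the sets of the sequence at most double, and the projected sequence reaches `G` at level `N`. -/
lemma exists_chain_of_isAdmissible (hρ : 0 < ρ) {G : Finset (S → ℝ)} (hGne : G.Nonempty)
    {T : Set (S → ℝ)} (hTm : ∀ a ∈ T, AEMeasurable a μ) (hGT : ∀ g ∈ G, ρ • g ∈ T)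
    {A : ℕ → Finset (S → ℝ)} (hA : IsAdmissible T A) {N : ℕ} (hN : G.card ≤ 2 ^ (2 ^ N)) :
    ∃ (B : ℕ → Finset (S → ℝ)) (φ : ℕ → (S → ℝ) → S → ℝ), (∀ s, B s ⊆ G) ∧
      (∀ s, (B s).card ≤ 2 ^ (2 ^ s)) ∧ (∀ s, ∀ f ∈ G, φ s f ∈ B s) ∧ (∀ f ∈ G, φ N f = f) ∧
      ∀ s, ∀ f ∈ G, psi2Norm μ (φ s f - f)
        ≤ ENNReal.ofReal (2 / ρ) * ⨅ a ∈ A s, psi2Norm μ (ρ • f - a) := by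
  classical
  have hν : ∀ a : S → ℝ, ∃ g ∈ G, ∀ f ∈ G, psi2Norm μ (ρ • g - a) ≤ psi2Norm μ (ρ • f - a) :=
    fun a => G.exists_min_image _ hGne
  choose ν hνG hνmin using hν
  have hnear : ∀ (s : ℕ) (f : S → ℝ), ∃ a ∈ A s, ∀ b ∈ A s,
      psi2Norm μ (ρ • f - a) ≤ psi2Norm μ (ρ • f - b) :=
    fun s f => (A s).exists_min_image _ (hA.nonempty s)
  choose near hnA hnmin using hnear
  -- Below `N`, take the nearest point of `A s`, then the point of `G` whose dilate is nearest to
  -- it; from `N` on, `G` itself fits the cardinality bound.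
  refine ⟨fun s => if s < N then (A s).image ν else G,
    fun s f => if s < N then ν (near s f) else f, ?_, ?_, ?_, ?_, ?_⟩
  · intro s
    dsimp only
    split_ifs
    · exact Finset.image_subset_iff.2 fun a _ => hνG a
    · exact Finset.Subset.refl _
  · intro s
    dsimp only
    split_ifs with h
    · exact Finset.card_image_le.trans (hA.card_le s)
    · refine hN.trans ?_
      have : N ≤ s := not_lt.1 h
      gcongr <;> norm_num
  · intro s f hf
    dsimp only
    split_ifs
    · exact Finset.mem_image_of_mem _ (hnA s f)
    · exact hf
  · intro f _
    simp
  · intro s f hf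
    dsimp only
    split_ifs
    · set a := near s f
      set g := ν a
      have haT : a ∈ T := hA.subset s (hnA s f)
      have hgm := hTm _ (hGT g (hνG a))
      have h1 : g - f = ρ⁻¹ • (ρ • g - ρ • f) := by
        rw [← smul_sub, smul_smul, inv_mul_cancel₀ hρ.ne', one_smul]
      have h2 : psi2Norm μ (ρ • g - ρ • f) ≤ 2 * psi2Norm μ (ρ • f - a) := by
        calc _ ≤ psi2Norm μ (ρ • g - a) + psi2Norm μ (a - ρ • f) :=
              psi2Norm_sub_le_sub_add_sub hgm (hTm a haT)
          _ ≤ psi2Norm μ (ρ • f - a) + psi2Norm μ (ρ • f - a) :=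
              add_le_add (hνmin a f hf) (psi2Norm_sub_comm _ _).le
          _ = _ := (two_mul _).symm
      calc psi2Norm μ (g - f) ≤ ENNReal.ofReal ρ⁻¹ * psi2Norm μ (ρ • g - ρ • f) := by
            rw [h1]; exact psi2Norm_smul_le (inv_pos.2 hρ) _
        _ ≤ ENNReal.ofReal ρ⁻¹ * (2 * psi2Norm μ (ρ • f - a)) := by gcongr
        _ = ENNReal.ofReal (2 / ρ) * psi2Norm μ (ρ • f - a) := by
            rw [← mul_assoc, div_eq_mul_inv, ENNReal.ofReal_mul (by norm_num), mul_comm _ (2 : ℝ≥0∞)]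
            simp
        _ ≤ _ := by
            gcongr
            exact le_iInf₂ (hnmin s f)
    · rw [sub_self, psi2Norm_zero]
      exact zero_le

/-- A finite class `G` on the unit sphere with `ρ • G ⊆ T`, where `γ₂(T)` is small compared with
`ρ`, satisfies the uniform empirical bound. -/
theorem ofReal_le_measure_forall_of_gamma2 (hk : 1 ≤ k)
    (hX : ∀ i, HasLaw (X i) μ P) (hind : iIndepFun X P) (hα : 0 < α) (hθ : 0 < θ) (hθ1 : θ < 1)
    (hρ : 0 < ρ) (G : Finset (S → ℝ)) (hGm : ∀ f ∈ G, AEMeasurable f μ)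
    (hGα : ∀ f ∈ G, psi2Norm μ f ≤ ENNReal.ofReal (α / 2))
    (hG1 : ∀ f ∈ G, ∫ x, (f x) ^ 2 ∂μ = 1)
    {T : Set (S → ℝ)} (hTm : ∀ a ∈ T, AEMeasurable a μ) (hGT : ∀ g ∈ G, ρ • g ∈ T)
    (hγ : ENNReal.ofReal (4096 * α / (θ * Real.sqrt k)) * gamma2Psi2 μ T ≤ ENNReal.ofReal ρ) :
    ENNReal.ofReal (1 - 2 * Real.exp (-(1 / 16384 * θ ^ 2 * k / α ^ 4)))
      ≤ P {ω | ∀ f ∈ G, |empiricalSq f (fun i => X i ω) - 1| ≤ θ} := by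
  classical
  rcases G.eq_empty_or_nonempty with rfl | hGne
  · simp only [Finset.notMem_empty, false_imp_iff, implies_true, Set.ofPred_true, measure_univ]
    rw [ENNReal.ofReal_le_one]
    linarith [Real.exp_pos (-(1 / 16384 * θ ^ 2 * k / α ^ 4))]
  have hk0 : (0 : ℝ) < k := by exact_mod_cast hk
  have hsk : 0 < Real.sqrt k := Real.sqrt_pos.2 hk0
  set M : ℝ := θ * Real.sqrt k * ρ / (4096 * α) with hM
  have hM0 : 0 < M := by positivity
  -- The hypothesis gives γ₂ ≤ M; the factor 2 makes room to choose a sequence without attaining the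
  -- infimum.
  have hγ' : gamma2Psi2 μ T < ENNReal.ofReal (2 * M) := by
    refine lt_of_le_of_lt ?_ ((ENNReal.ofReal_lt_ofReal_iff (by positivity)).2
      (by linarith : M < 2 * M))
    have hc : 0 < 4096 * α / (θ * Real.sqrt k) := by positivity
    rw [mul_comm, ← ENNReal.le_div_iff_mul_le (Or.inl (ENNReal.ofReal_pos.2 hc).ne')
      (Or.inl ENNReal.ofReal_ne_top), ← ENNReal.ofReal_div_of_pos hc] at hγ
    refine hγ.trans (le_of_eq ?_)
    congr 1
    rw [hM]
    field_simp
  unfold gamma2Psi2 gamma2 at hγ'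
  simp only [iInf_lt_iff] at hγ'
  obtain ⟨A, hA, hAM⟩ := hγ'
  obtain ⟨N, hkN, hGN⟩ : ∃ N : ℕ, k ≤ 2 ^ N ∧ G.card ≤ 2 ^ (2 ^ N) := by
    refine ⟨k + G.card, ?_, ?_⟩
    · exact (Nat.le_add_right _ _).trans Nat.lt_two_pow_self.le
    · exact (Nat.le_add_left _ _).trans (Nat.lt_two_pow_self.le.trans Nat.lt_two_pow_self.le)
  obtain ⟨B, φ, hBG, hBc, hφ, hφN, hdist⟩ :=
    exists_chain_of_isAdmissible hρ hGne hTm hGT hA hGN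
  have hφG : ∀ s, ∀ f ∈ G, φ s f ∈ G := fun s f hf => hBG s (hφ s f hf)
  have hlt : ∀ f ∈ G, psi2Norm μ f < ∞ := fun f hf => (hGα f hf).trans_lt ENNReal.ofReal_lt_top
  have hdlt : ∀ f ∈ G, ∀ g ∈ G, psi2Norm μ (f - g) < ∞ := fun f hf g hg =>
    (psi2Norm_sub_le (hGm f hf)).trans_lt (ENNReal.add_lt_top.2 ⟨hlt f hf, hlt g hg⟩)
  set q : ℕ → ℝ := fun s => (2 : ℝ) ^ ((s : ℝ) / 2) with hq
  have hq0 : ∀ s, 0 < q s := two_rpow_half_pos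
  set L : ℝ := θ * Real.sqrt k / (512 * α) with hL
  have hL0 : 0 < L := by positivity
  set Q : ℝ := ∑ s ∈ Finset.range N, q s with hQ
  have hQ0 : 0 ≤ Q := Finset.sum_nonneg fun s _ => (hq0 s).le
  -- Adding ε to every distance gives genuine, positive ψ₂ bounds, at a total cost of at most `L`.
  -- The links themselves cost 8M/ρ = L, and 2L fits within θ√k/(192α).
  set ε : ℝ := L / (Q + 1) with hε
  have hε0 : 0 < ε := by positivity
  have hεQ : Q * ε ≤ L := by
    rw [hε, mul_div_assoc', div_le_iff₀ (by positivity)]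
    nlinarith
  refine ofReal_le_measure_forall_abs_empiricalSq_sub_one_le hk hX hind hα hθ hθ1 hGne hGm ?_ hG1
    B hBG hBc φ hφ hkN hφN (fun f g => (psi2Norm μ (f - g)).toReal + ε) ?_ ?_
  · intro f hf
    exact isPsi2Bound_of_psi2Norm_lt ((hGα f hf).trans_lt
      ((ENNReal.ofReal_lt_ofReal_iff hα).2 (by linarith)))
  · intro f hf g hg
    exact isPsi2Bound_of_psi2Norm_lt ((ENNReal.lt_ofReal_iff_toReal_lt (hdlt f hf g hg).ne).2
      (by linarith))
  · intro f hf
    have htot : ∑' s, ENNReal.ofReal (q s) * psi2Norm μ (φ s f - f) ≤ ENNReal.ofReal (4 * M / ρ) := by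
      calc _ ≤ ∑' s, ENNReal.ofReal (2 / ρ) *
            (ENNReal.ofReal (q s) * ⨅ a ∈ A s, psi2Norm μ (ρ • f - a)) := by
            refine ENNReal.tsum_le_tsum fun s => ?_
            rw [mul_left_comm]
            gcongr
            exact hdist s f hf
        _ = ENNReal.ofReal (2 / ρ) *
            ∑' s, ENNReal.ofReal (q s) * ⨅ a ∈ A s, psi2Norm μ (ρ • f - a) := ENNReal.tsum_mul_left
        _ ≤ ENNReal.ofReal (2 / ρ) * ENNReal.ofReal (2 * M) := by
            gcongr
            exact (le_iSup₂ (f := fun t (_ : t ∈ T) => ∑' s : ℕ, ENNReal.ofReal (q s) *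
              ⨅ a ∈ A s, psi2Norm μ (t - a)) (ρ • f) (hGT f hf)).trans hAM.le
        _ = _ := by
            rw [← ENNReal.ofReal_mul (by positivity)]
            congr 1
            ring
    have hlinks : ∑ s ∈ Finset.range N, ENNReal.ofReal (q s) * psi2Norm μ (φ s f - φ (s + 1) f)
        ≤ ENNReal.ofReal (8 * M / ρ) := by
      calc _ ≤ ∑ s ∈ Finset.range N, (ENNReal.ofReal (q s) * psi2Norm μ (φ s f - f)
              + ENNReal.ofReal (q (s + 1)) * psi2Norm μ (φ (s + 1) f - f)) := by
            refine Finset.sum_le_sum fun s _ => ?_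
            have h1 : psi2Norm μ (φ s f - φ (s + 1) f)
                ≤ psi2Norm μ (φ s f - f) + psi2Norm μ (φ (s + 1) f - f) := by
              rw [psi2Norm_sub_comm (φ (s + 1) f)]
              exact psi2Norm_sub_le_sub_add_sub (hGm _ (hφG s f hf)) (hGm f hf)
            have h2 : q s ≤ q (s + 1) := by
              refine Real.rpow_le_rpow_of_exponent_le (by norm_num) ?_
              push_cast
              linarith
            calc _ ≤ ENNReal.ofReal (q s) *
                  (psi2Norm μ (φ s f - f) + psi2Norm μ (φ (s + 1) f - f)) := by gcongr
              _ ≤ _ := by rw [mul_add]; gcongr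
        _ ≤ ENNReal.ofReal (4 * M / ρ) + ENNReal.ofReal (4 * M / ρ) := by
            rw [Finset.sum_add_distrib]
            refine add_le_add ((ENNReal.sum_le_tsum _).trans htot)
              ((ENNReal.sum_le_tsum _).trans (le_trans ?_ htot))
            exact ENNReal.tsum_comp_le_tsum_of_injective (add_left_injective 1)
              (fun s => ENNReal.ofReal (q s) * psi2Norm μ (φ s f - f))
        _ = _ := by
            rw [← ENNReal.ofReal_add (by positivity) (by positivity)]
            congr 1
            ring
    have hreal : ∑ s ∈ Finset.range N, q s * (psi2Norm μ (φ s f - φ (s + 1) f)).toReal ≤ L := by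
      have h1 : ENNReal.ofReal (∑ s ∈ Finset.range N,
          q s * (psi2Norm μ (φ s f - φ (s + 1) f)).toReal) ≤ ENNReal.ofReal L := by
        rw [ENNReal.ofReal_sum_of_nonneg fun s _ =>
          mul_nonneg (hq0 s).le ENNReal.toReal_nonneg]
        refine le_trans (le_of_eq (Finset.sum_congr rfl fun s _ => ?_))
          (hlinks.trans (le_of_eq ?_))
        · rw [ENNReal.ofReal_mul (hq0 s).le,
            ENNReal.ofReal_toReal (hdlt _ (hφG s f hf) _ (hφG (s + 1) f hf)).ne]
        · congr 1
          rw [hM, hL]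
          field_simp
          norm_num
      exact (ENNReal.ofReal_le_ofReal_iff hL0.le).1 h1
    calc ∑ s ∈ Finset.range N, q s * ((psi2Norm μ (φ s f - φ (s + 1) f)).toReal + ε)
        = ∑ s ∈ Finset.range N, q s * (psi2Norm μ (φ s f - φ (s + 1) f)).toReal + Q * ε := by
          simp_rw [mul_add]
          rw [Finset.sum_add_distrib, hQ, Finset.sum_mul]
      _ ≤ L + L := add_le_add hreal hεQ
      _ ≤ _ := by
          rw [hL, ← two_mul, mul_div_assoc', div_le_div_iff₀ (by positivity) (by positivity)]
          have : 0 < θ * Real.sqrt k * α := by positivity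
          nlinarith

end Gamma

/-! ### Critical levels and rescaling -/

section Levels

variable {S : Type u} [MeasurableSpace S] {μ : Measure S} {Ω : Type v}
  [MeasurableSpace Ω] {P : Measure Ω} {k : ℕ} {X : Fin k → Ω → S}
  {F : Set (S → ℝ)} {c α θ : ℝ} {f : S → ℝ}

lemma psi2Norm_le_of_psi2Diam (h : psi2Diam μ F = ENNReal.ofReal α) (hf : f ∈ F) :
    psi2Norm μ f ≤ ENNReal.ofReal (α / 2) := by
  rw [ENNReal.ofReal_div_of_pos (by norm_num), ENNReal.ofReal_ofNat,
    ENNReal.le_div_iff_mul_le (by simp) (by simp), mul_comm, ← h]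
  unfold psi2Diam
  gcongr
  exact le_iSup₂ (f := fun f (_ : f ∈ F) => psi2Norm μ f) f hf

/-- Strictly above the infimum a smaller good level exists; in the equality case it is the attained
one, as positivity of the norm excludes a zero infimum. -/
lemma exists_goodLevel_le_of_mem_aboveRStar (hf : f ∈ aboveRStar μ F c α θ k)
    (hf0 : 0 < ∫ x, (f x) ^ 2 ∂μ) :
    ∃ ρ ∈ goodLevels μ F c α θ k, ρ ≤ Real.sqrt (∫ x, (f x) ^ 2 ∂μ) := by
  obtain ⟨-, hle, heq⟩ := hf
  set I := ∫ x, (f x) ^ 2 ∂μ with hI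
  have hs0 : 0 < Real.sqrt I := Real.sqrt_pos.2 hf0
  have hIs : ENNReal.ofReal I = ENNReal.ofReal (Real.sqrt I) ^ 2 := by
    rw [← ENNReal.ofReal_pow hs0.le, Real.sq_sqrt hf0.le]
  rw [hIs] at hle heq
  rcases hle.lt_or_eq with h | h
  · have h1 : rStar μ F c α θ k < ENNReal.ofReal (Real.sqrt I) := lt_of_pow_lt_pow_left' 2 h
    unfold rStar at h1
    simp only [iInf_lt_iff] at h1
    obtain ⟨ρ, hρ, hlt⟩ := h1
    exact ⟨ρ, hρ, (ENNReal.ofReal_lt_ofReal_iff'.1 hlt).1.le⟩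
  · rcases heq h with h0 | ⟨ρ, hρ, hρr⟩
    · rw [h0] at h
      have : ENNReal.ofReal (Real.sqrt I) ^ 2 ≠ 0 :=
        pow_ne_zero 2 (ENNReal.ofReal_pos.2 hs0).ne'
      exact absurd h.symm (by simpa using this)
    · refine ⟨ρ, hρ, ?_⟩
      rw [← hρr] at h
      have h2 := (ENNReal.pow_right_strictMono (n := 2) (by norm_num)).injective h
      exact ((ENNReal.ofReal_le_ofReal_iff hs0.le).1 h2.le)

lemma empiricalSq_smul {S : Type u} {k : ℕ} (t : ℝ) (f : S → ℝ) (x : Fin k → S) :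
    empiricalSq (t • f) x = t ^ 2 * empiricalSq f x := by
  simp only [empiricalSq, Pi.smul_apply, smul_eq_mul, mul_pow, ← Finset.mul_sum]
  ring

lemma integral_sq_smul (t : ℝ) (f : S → ℝ) :
    ∫ x, ((t • f) x) ^ 2 ∂μ = t ^ 2 * ∫ x, (f x) ^ 2 ∂μ := by
  simp only [Pi.smul_apply, smul_eq_mul, mul_pow]
  exact integral_const_mul _ _

/-- Functions vanishing almost everywhere cannot be normalized; both sides of the bound are almost
surely 0. -/
lemma ae_twoSidedBound_of_integral_sq_eq_zero (hX : ∀ i, HasLaw (X i) μ P) (hf : MemLp f 2 μ)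
    (h0 : ∫ x, (f x) ^ 2 ∂μ = 0) : ∀ᵐ ω ∂P, TwoSidedBound μ θ f (fun i => X i ω) := by
  have h1 : ∀ᵐ x ∂μ, f x = 0 := by
    filter_upwards [(integral_eq_zero_iff_of_nonneg (fun x => sq_nonneg (f x))
      hf.integrable_sq).1 h0] with x hx
    simpa using hx
  have h2 : ∀ i, ∀ᵐ ω ∂P, f (X i ω) = 0 := fun i => by
    rw [← (hX i).map_eq] at h1
    exact ae_of_ae_map (hX i).aemeasurable h1
  filter_upwards [ae_all_iff.2 h2] with ω hω
  have : empiricalSq f (fun i => X i ω) = 0 := by simp [empiricalSq, hω]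
  simp [TwoSidedBound, this, h0]

lemma nullMeasurableSet_twoSidedBound (hX : ∀ i, HasLaw (X i) μ P) (hf : MemLp f 2 μ) :
    NullMeasurableSet {ω | TwoSidedBound μ θ f (fun i => X i ω)} P := by
  have h := aemeasurable_empiricalSq hX hf.1.aemeasurable
  exact (nullMeasurableSet_le aemeasurable_const h).inter
    (nullMeasurableSet_le h aemeasurable_const)

/-- Non-strict inequalities survive limits: pointwise convergence handles the sample, L₂ convergence
the expectation. -/
lemma twoSidedBound_of_tendsto {w : ℕ → S → ℝ} (hw : ∀ n, MemLp (w n) 2 μ) (hf : MemLp f 2 μ)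
    (hpt : ∀ x, Tendsto (fun n => w n x) atTop (𝓝 (f x)))
    (h2 : Tendsto (fun n => eLpNorm (w n - f) 2 μ) atTop (𝓝 0)) {x : Fin k → S}
    (h : ∀ n, TwoSidedBound μ θ (w n) x) : TwoSidedBound μ θ f x :=
  ⟨le_of_tendsto_of_tendsto' ((tendsto_integral_sq hw hf h2).const_mul _)
      (tendsto_empiricalSq hpt x) fun n => (h n).1,
    le_of_tendsto_of_tendsto' (tendsto_empiricalSq hpt x)
      ((tendsto_integral_sq hw hf h2).const_mul _) fun n => (h n).2⟩

/-- The ratio bound for a finite subclass above the critical level of a star-shaped class. -/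
theorem ofReal_le_measure_forall_twoSidedBound [IsProbabilityMeasure μ] [IsProbabilityMeasure P]
    (hk : 1 ≤ k) (hX : ∀ i, HasLaw (X i) μ P) (hind : iIndepFun X P)
    (hF : ∀ f ∈ F, MemLp f 2 μ) (hα : 0 < α) (hθ : 0 < θ) (hθ1 : θ < 1)
    (hstar : StarConvex ℝ 0 F) (G : Finset (S → ℝ))
    (hG : (G : Set (S → ℝ)) ⊆ aboveRStar μ F 4096 α θ k)
    (hGα : ∀ f ∈ G, 0 < ∫ x, (f x) ^ 2 ∂μ →
      psi2Norm μ ((Real.sqrt (∫ x, (f x) ^ 2 ∂μ))⁻¹ • f) ≤ ENNReal.ofReal (α / 2)) :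
    ENNReal.ofReal (1 - 2 * Real.exp (-(1 / 16384 * θ ^ 2 * k / α ^ 4)))
      ≤ P {ω | ∀ f ∈ G, TwoSidedBound μ θ f (fun i => X i ω)} := by
  classical
  set I : (S → ℝ) → ℝ := fun f => ∫ x, (f x) ^ 2 ∂μ with hI
  set nrm : (S → ℝ) → S → ℝ := fun f => (Real.sqrt (I f))⁻¹ • f with hnrm
  set G' := G.filter (fun f => 0 < I f) with hG'
  have hI0 : ∀ f, 0 ≤ I f := fun f => integral_nonneg fun x => sq_nonneg _
  have hnull : ∀ᵐ ω ∂P, ∀ f ∈ G, I f = 0 → TwoSidedBound μ θ f (fun i => X i ω) := by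
    rw [Finset.eventually_all]
    intro f hf
    by_cases h : I f = 0
    · filter_upwards [ae_twoSidedBound_of_integral_sq_eq_zero (θ := θ) hX (hF f (hG hf).1) h]
        with ω hω _ using hω
    · exact ae_of_all _ fun ω h' => absurd h' h
  rcases G'.eq_empty_or_nonempty with hemp | hne
  · refine le_trans (ENNReal.ofReal_le_one.2 ?_) (?_ : (1 : ℝ≥0∞) ≤ _)
    · linarith [Real.exp_pos (-(1 / 16384 * θ ^ 2 * k / α ^ 4))]
    · rw [← measure_univ (μ := P)]
      refine measure_mono_ae ?_
      filter_upwards [hnull] with ω hω _ f hf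
      refine hω f hf ((hI0 f).antisymm' (not_lt.1 fun h0 => ?_))
      exact Finset.notMem_empty f (hemp ▸ Finset.mem_filter.2 ⟨hf, h0⟩)
  have hlev : ∀ f : S → ℝ, ∃ ρ, f ∈ G' → ρ ∈ goodLevels μ F 4096 α θ k ∧ ρ ≤ Real.sqrt (I f) := by
    intro f
    by_cases hf : f ∈ G'
    · obtain ⟨hfG, hf0⟩ := Finset.mem_filter.1 hf
      obtain ⟨ρ, h1, h2⟩ := exists_goodLevel_le_of_mem_aboveRStar (hG hfG) hf0
      exact ⟨ρ, fun _ => ⟨h1, h2⟩⟩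
    · exact ⟨0, fun h => absurd h hf⟩
  choose lev hlev using hlev
  -- Finiteness gives a least good level, which lies below every norm in `G'`; no attained infimum
  -- over `F` is needed.
  obtain ⟨f₀, hf₀, hmin⟩ := G'.exists_min_image lev hne
  set ρ := lev f₀ with hρdef
  have hρ : 0 < ρ := (hlev f₀ hf₀).1.1
  have hnI : ∀ f ∈ G', I (nrm f) = 1 := by
    intro f hf
    have h0 := (Finset.mem_filter.1 hf).2
    simp only [hI, hnrm]
    rw [integral_sq_smul, inv_pow, Real.sq_sqrt h0.le]
    exact inv_mul_cancel₀ h0.ne'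
  have h := ofReal_le_measure_forall_of_gamma2 (T := sphereSection μ F ρ) hk hX hind hα hθ hθ1 hρ
    (G'.image nrm) ?_ ?_ ?_ ?_ ?_ (hlev f₀ hf₀).1.2
  · refine h.trans (measure_mono_ae ?_)
    filter_upwards [hnull] with ω hω hgood f hf
    rcases (hI0 f).eq_or_lt with h0 | h0
    · exact hω f hf h0.symm
    · have hb := hgood (nrm f) (Finset.mem_image_of_mem _ (Finset.mem_filter.2 ⟨hf, h0⟩))
      rw [hnrm, empiricalSq_smul, inv_pow, Real.sq_sqrt h0.le, abs_le,
        inv_mul_eq_div] at hb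
      obtain ⟨hb1, hb2⟩ := hb
      have h3 : 1 - θ ≤ empiricalSq f (fun i => X i ω) / I f := by linarith
      have h4 : empiricalSq f (fun i => X i ω) / I f ≤ 1 + θ := by linarith
      exact ⟨(le_div_iff₀ h0).1 h3, (div_le_iff₀ h0).1 h4⟩
  · intro g hg
    obtain ⟨f, hf, rfl⟩ := Finset.mem_image.1 hg
    exact ((hF f (hG (Finset.mem_filter.1 hf).1).1).const_smul _).1.aemeasurable
  · intro g hg
    obtain ⟨f, hf, rfl⟩ := Finset.mem_image.1 hg
    exact hGα f (Finset.mem_filter.1 hf).1 (Finset.mem_filter.1 hf).2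
  · intro g hg
    obtain ⟨f, hf, rfl⟩ := Finset.mem_image.1 hg
    exact hnI f hf
  · exact fun a ha => (hF a ha.1).1.aemeasurable
  · intro g hg
    obtain ⟨f, hf, rfl⟩ := Finset.mem_image.1 hg
    have hfG := (Finset.mem_filter.1 hf).1
    have hs0 : 0 < Real.sqrt (I f) := Real.sqrt_pos.2 (Finset.mem_filter.1 hf).2
    have hle : ρ ≤ Real.sqrt (I f) := (hmin f hf).trans (hlev f hf).2
    refine ⟨?_, ?_⟩
    · simp only [hnrm, smul_smul, ← div_eq_mul_inv]
      exact hstar.smul_mem (hG hfG).1 (by positivity) ((div_le_one hs0).2 hle)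
    · rw [integral_sq_smul]
      have h1 := hnI f hf
      simp only [hI] at h1
      rw [h1, mul_one, Real.sqrt_sq hρ.le]

end Levels

/-! ### The three cases -/

theorem mainTheorem1 :
    ∃ c cbar : ℝ, 0 < c ∧ 0 < cbar ∧
      ∀ (S : Type u) [MeasurableSpace S] (μ : Measure S) [IsProbabilityMeasure μ]
        (Ω : Type v) [MeasurableSpace Ω] (P : Measure Ω) [IsProbabilityMeasure P]
        (k : ℕ) (_ : 1 ≤ k) (X : Fin k → Ω → S)
        (_ : ∀ i, HasLaw (X i) μ P) (_ : iIndepFun X P)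
        (F : Set (S → ℝ)) (_ : ∀ f ∈ F, MemLp f 2 μ)
        (α : ℝ) (_ : 0 < α) (θ : ℝ) (_ : 0 < θ) (_ : θ < 1),
        -- `α` is the `ψ₂` diameter of the star-shaped class `F`
        (StarConvex ℝ 0 F → psi2Diam μ F = ENNReal.ofReal α →
          HoldsForAllWithProb μ P (1 - 2 * Real.exp (-(cbar * θ ^ 2 * k / α ^ 4)))
            {f | f ∈ aboveRStar μ F c α θ k ∧ 1 ≤ ∫ y, (f y) ^ 2 ∂μ}
            (fun f ω => TwoSidedBound μ θ f (fun i => X i ω))) ∧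
        -- `α` is the `ψ₂` diameter of the normalized class `{f / ‖f‖₂ : f ∈ F}`
        (StarConvex ℝ 0 F → psi2Diam μ (normalizedClass μ F) = ENNReal.ofReal α →
          HoldsForAllWithProb μ P (1 - 2 * Real.exp (-(cbar * θ ^ 2 * k / α ^ 4)))
            (aboveRStar μ F c α θ k)
            (fun f ω => TwoSidedBound μ θ f (fun i => X i ω))) ∧
        -- `F` is a subset of the unit sphere, not necessarily star-shaped
        ((∀ f ∈ F, ∫ y, (f y) ^ 2 ∂μ = 1) → psi2Diam μ F = ENNReal.ofReal α →
          ENNReal.ofReal (c * α) * gamma2Psi2 μ F ≤ ENNReal.ofReal (θ * Real.sqrt k) →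
          HoldsForAllWithProb μ P (1 - 2 * Real.exp (-(cbar * θ ^ 2 * k / α ^ 4)))
            F
            (fun f ω => |empiricalSq f (fun i => X i ω) - 1| ≤ θ)) := by
  refine ⟨4096, 1 / 16384, by norm_num, by norm_num, ?_⟩
  intro S _ μ _ Ω _ P _ k hk X hX hind F hF α hα θ hθ hθ1
  refine ⟨fun hstar hdiam => ?_, fun hstar hdiam => ?_, fun hsph hdiam hγ => ?_⟩
  · refine holdsForAllWithProb_of_finset
      (fun f hf => nullMeasurableSet_twoSidedBound hX (hF f hf.1.1))
      (fun f w hf hw hpt h2 ω h => twoSidedBound_of_tendsto (fun n => hF _ (hw n).1.1)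
        (hF f hf.1.1) hpt h2 h) fun G hG => ?_
    refine ofReal_le_measure_forall_twoSidedBound hk hX hind hF hα hθ hθ1 hstar G
      (fun f hf => (hG hf).1) fun f hf _ => ?_
    -- Dividing by a norm at least 1 shrinks `f` pointwise, so the diameter of `F` also controls the
    -- normalized functions.
    refine le_trans (psi2Norm_mono fun x => ?_) (psi2Norm_le_of_psi2Diam hdiam (hG hf).1.1)
    have h1 : 1 ≤ Real.sqrt (∫ x, (f x) ^ 2 ∂μ) := Real.one_le_sqrt.2 (hG hf).2
    rw [Pi.smul_apply, smul_eq_mul, abs_mul, abs_of_nonneg (by positivity)]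
    exact mul_le_of_le_one_left (abs_nonneg _) (inv_le_one_of_one_le₀ h1)
  · refine holdsForAllWithProb_of_finset
      (fun f hf => nullMeasurableSet_twoSidedBound hX (hF f hf.1))
      (fun f w hf hw hpt h2 ω h => twoSidedBound_of_tendsto (fun n => hF _ (hw n).1)
        (hF f hf.1) hpt h2 h) fun G hG => ?_
    exact ofReal_le_measure_forall_twoSidedBound hk hX hind hF hα hθ hθ1 hstar G hG fun f hf h0 =>
      psi2Norm_le_of_psi2Diam hdiam ⟨f, (hG hf).1, h0, rfl⟩
  · refine holdsForAllWithProb_of_finset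
      (fun f hf => nullMeasurableSet_le
        ((aemeasurable_empiricalSq hX (hF f hf).1.aemeasurable).sub_const 1).abs
        aemeasurable_const)
      (fun f w _ _ hpt _ ω h => le_of_tendsto'
        ((tendsto_empiricalSq hpt (fun i => X i ω)).sub_const 1).abs h) fun G hG => ?_
    have hsk : 0 < Real.sqrt k := Real.sqrt_pos.2 (by exact_mod_cast hk)
    -- On the sphere no rescaling is needed: ρ = 1 and T = F, so star-shapedness plays no role.
    refine ofReal_le_measure_forall_of_gamma2 (ρ := 1) (T := F) hk hX hind hα hθ hθ1 one_pos G
      (fun f hf => (hF f (hG hf)).1.aemeasurable)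
      (fun f hf => psi2Norm_le_of_psi2Diam hdiam (hG hf)) (fun f hf => hsph f (hG hf))
      (fun a ha => (hF a ha).1.aemeasurable) (fun g hg => by rw [one_smul]; exact hG hg) ?_
    have hts : 0 < θ * Real.sqrt k := mul_pos hθ hsk
    rw [ENNReal.ofReal_div_of_pos hts, div_eq_mul_inv, mul_right_comm, ← div_eq_mul_inv,
      ENNReal.ofReal_one]
    exact ENNReal.div_le_of_le_mul (by rwa [one_mul])
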